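/- Let $\lambda>0$ and let $f:\mathbb R\to\mathbb R$ satisfy $f(0)=0$, $f'(0)=a$ and $f(u)=au+h(u)$, where $h$ is a polynomial all of whose monomials have degree at least $2$. For $\varepsilon>0$ put $M_1(u)=\frac u2+\frac{\varepsilon f(u)}{2\lambda}$, $M_2(u)=\frac u2-\frac{\varepsilon f(u)}{2\lambda}$, and for a function $g$ of $x$ put $\mathcal M_1(g)=M_1(g)-\frac{\varepsilon\lambda}{2}\partial_xg$, $\mathcal M_2(g)=M_2(g)+\frac{\varepsilon\lambda}{2}\partial_xg$. The BGK model is $$\partial_tf_1^\varepsilon+\tfrac{\lambda}{\varepsilon}\partial_xf_1^\varepsilon=\tfrac1{\varepsilon^2}(M_1(u)-f_1^\varepsilon),\qquad \partial_tf_2^\varepsilon-\tfrac{\lambda}{\varepsilon}\partial_xf_2^\varepsilon=\tfrac1{\varepsilon^2}(M_2(u)-f_2^\varepsilon),\qquad u=f_1^\varepsilon+f_2^\varepsilon .$$ A convex dissipative kinetic entropy for it is a function $\mathcal H(f_1,f_2)=H_1(f_1)+H_2(f_2)$, with $H_1,H_2$ convex and $C^1$ on open intervals $D_1,D_2$, together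 with a convex $C^1$ entropy $\eta$ of $\partial_tu+\partial_xf(u)=0$ on an open interval $J$ with $M_i(J)\subset D_i$, such that $\mathcal H(M_1(u),M_2(u))=\eta(u)$ for $u\in J$ and, for some $c>0$ and all $\mathbf f=(f_1,f_2)\in D_1\times D_2$ with $f_1+f_2=u\in J$, both $\mathcal H(\mathbf f)\ge\eta(u)$ and $\mathcal H'(\mathbf f)\cdot(\mathbf M(u)-\mathbf f)\le-c\,|\mathbf f-\mathbf M(u)|^2$, where $\mathbf M=(M_1,M_2)$. Let $M>0$, $\varepsilon_0>0$, $s>\frac12+1$ and $u_0\in H^{s+1}(\mathbb R)$. For $T^*>0$ let $\bar u\in C([0,T^*];H^{s+1}(\mathbb R))$ be a solution, smooth for $0<t<T^*$, of $$\partial_t\bar u+\partial_xf(\bar u)=\lambda^2\partial_{xx}\bar u,\qquad \bar u(0)=u_0 .$$ For $0<\varepsilon\le\varepsilon_0$ let $\mathbf f^\varepsilon=(f_1^\varepsilon,f_2^\varepsilon)$ be a classical solution of the BGK model on $[0,T^*]\times\mathbb R$ with the well-prepared initial data $\mathbf f^\varepsilon(0)=(\mathcal M_1(u_0),\mathcal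 M_2(u_0))$, such that the model has a convex dissipative kinetic entropy whose domain contains the values of the solution on $[0,T^*]$ (that is, $f_i^\varepsilon\in D_i$ and $u\in J$), and such that $|f_i^\varepsilon|\le M$ and $|\partial_tf_i^\varepsilon|\le M$ for $i=1,2$ on this strip. Then, for all $t\in[0,T^*]$, $$\|(u-\bar u)(t)\|_{L^2(\mathbb R)}\le C\sqrt\varepsilon\;e^{K(|\bar u|_\infty,\,|\partial_x\bar u|_\infty)\,t},$$ where $|\cdot|_\infty$ is the supremum over $[0,T^*]\times\mathbb R$, the function $K$ depends only on $\lambda$, $f$, $M$, and the constant $C$ depends only on $\lambda,f,M,\varepsilon_0,s,u_0$; neither depends on $\varepsilon$, $t$ or $T^*$. -/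

import Mathlib

open MeasureTheory Set Filter Topology
open scoped ENNReal SchwartzMap ContDiff

/-! ### The flux and the Maxwellians -/

/-- Structural assumptions on the flux `f`: `f 0 = 0`, `f' 0 = a`, and `f u = a u + h u` with `h` a
polynomial all of whose monomials have degree at least two. A polynomial is Lipschitz on bounded
sets, so "Lipschitz" is understood locally (a globally Lipschitz polynomial would be affine). -/
structure FluxAssumption (f : ℝ → ℝ) (a : ℝ) : Prop where
  locallyLipschitz : LocallyLipschitz f
  map_zero : f 0 = 0
  deriv_zero : deriv f 0 = a
  exists_poly : ∃ h : Polynomial ℝ, Polynomial.X ^ 2 ∣ h ∧ ∀ r, f r = a * r + h.eval r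

/-- The Maxwellian `M₁ u = u / 2 + ε f u / (2 λ)`. -/
noncomputable def maxwellian₁ (lam : ℝ) (f : ℝ → ℝ) (ε : ℝ) (u : ℝ) : ℝ :=
  u / 2 + ε * f u / (2 * lam)

/-- The Maxwellian `M₂ u = u / 2 - ε f u / (2 λ)`. -/
noncomputable def maxwellian₂ (lam : ℝ) (f : ℝ → ℝ) (ε : ℝ) (u : ℝ) : ℝ :=
  u / 2 - ε * f u / (2 * lam)

/-- The corrected Maxwellian `𝓜₁(g) = M₁(g) - (ε λ / 2) ∂ₓ g` of a function `g` of `x`. -/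
noncomputable def correctedMaxwellian₁ (lam : ℝ) (f : ℝ → ℝ) (ε : ℝ) (g : ℝ → ℝ) (x : ℝ) : ℝ :=
  maxwellian₁ lam f ε (g x) - ε * lam * deriv g x / 2

/-- The corrected Maxwellian `𝓜₂(g) = M₂(g) + (ε λ / 2) ∂ₓ g` of a function `g` of `x`. -/
noncomputable def correctedMaxwellian₂ (lam : ℝ) (f : ℝ → ℝ) (ε : ℝ) (g : ℝ → ℝ) (x : ℝ) : ℝ :=
  maxwellian₂ lam f ε (g x) + ε * lam * deriv g x / 2

/-! ### The discrete velocities BGK model -/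

/-- `(f₁, f₂)` is a classical solution on `[0, T] × ℝ` of the diffusively scaled BGK model
`∂ₜ f₁ + (λ/ε) ∂ₓ f₁ = (M₁(u) - f₁)/ε²`, `∂ₜ f₂ - (λ/ε) ∂ₓ f₂ = (M₂(u) - f₂)/ε²`, `u = f₁ + f₂`:
continuous up to the boundary of the strip and continuously differentiable inside. -/
structure IsBGKSolution (lam : ℝ) (f : ℝ → ℝ) (ε T : ℝ) (f₁ f₂ : ℝ → ℝ → ℝ) : Prop where
  cont₁ : ContinuousOn (Function.uncurry f₁) (Icc 0 T ×ˢ univ)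
  cont₂ : ContinuousOn (Function.uncurry f₂) (Icc 0 T ×ˢ univ)
  contDiff₁ : ContDiffOn ℝ 1 (Function.uncurry f₁) (Ioo 0 T ×ˢ univ)
  contDiff₂ : ContDiffOn ℝ 1 (Function.uncurry f₂) (Ioo 0 T ×ˢ univ)
  eqn₁ : ∀ t ∈ Ioo 0 T, ∀ x,
    deriv (fun τ => f₁ τ x) t + lam / ε * deriv (f₁ t) x
      = 1 / ε ^ 2 * (maxwellian₁ lam f ε (f₁ t x + f₂ t x) - f₁ t x)
  eqn₂ : ∀ t ∈ Ioo 0 T, ∀ x,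
    deriv (fun τ => f₂ τ x) t - lam / ε * deriv (f₂ t) x
      = 1 / ε ^ 2 * (maxwellian₂ lam f ε (f₁ t x + f₂ t x) - f₂ t x)

/-- A convex, dissipative kinetic entropy `𝓗(f₁, f₂) = H₁(f₁) + H₂(f₂)` of the BGK model.
It relaxes a convex entropy `η` of the scalar conservation law `∂ₜ u + ∂ₓ f(u) = 0` (every
convex `η` is an entropy of a scalar law), on an open interval `J` of macroscopic states and on open
intervals `D₁`, `D₂` of densities that contain the corresponding Maxwellians. -/
structure KineticEntropy (lam : ℝ) (f : ℝ → ℝ) (ε : ℝ) where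
  /-- macroscopic states -/
  J : Set ℝ
  /-- values of the first density -/
  D₁ : Set ℝ
  /-- values of the second density -/
  D₂ : Set ℝ
  /-- macroscopic entropy -/
  η : ℝ → ℝ
  /-- first component of the kinetic entropy -/
  H₁ : ℝ → ℝ
  /-- second component of the kinetic entropy -/
  H₂ : ℝ → ℝ
  isOpen_J : IsOpen J
  isOpen_D₁ : IsOpen D₁
  isOpen_D₂ : IsOpen D₂
  maxwellian₁_mem : ∀ u ∈ J, maxwellian₁ lam f ε u ∈ D₁
  maxwellian₂_mem : ∀ u ∈ J, maxwellian₂ lam f ε u ∈ D₂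
  /-- `η` is a convex entropy of the conservation law -/
  convex_η : ConvexOn ℝ J η
  /-- convexity of the kinetic entropy -/
  convex_H₁ : ConvexOn ℝ D₁ H₁
  convex_H₂ : ConvexOn ℝ D₂ H₂
  contDiff_η : ContDiffOn ℝ 1 η J
  contDiff_H₁ : ContDiffOn ℝ 1 H₁ D₁
  contDiff_H₂ : ContDiffOn ℝ 1 H₂ D₂
  /-- at equilibrium the kinetic entropy is `η`: `𝓗(M(u)) = η(u)` -/
  equilibrium : ∀ u ∈ J, H₁ (maxwellian₁ lam f ε u) + H₂ (maxwellian₂ lam f ε u) = η u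
  /-- the Maxwellians minimize: `η(u) = min {𝓗(f₁, f₂) | f₁ + f₂ = u}` -/
  minimum : ∀ g₁ ∈ D₁, ∀ g₂ ∈ D₂, g₁ + g₂ ∈ J → η (g₁ + g₂) ≤ H₁ g₁ + H₂ g₂
  /-- strict dissipation: `𝓗'(f) · (M(u) - f) ≤ - c |f - M(u)|²` -/
  dissipative : ∃ c > 0, ∀ g₁ ∈ D₁, ∀ g₂ ∈ D₂, g₁ + g₂ ∈ J →
    deriv H₁ g₁ * (maxwellian₁ lam f ε (g₁ + g₂) - g₁)
        + deriv H₂ g₂ * (maxwellian₂ lam f ε (g₁ + g₂) - g₂)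
      ≤ -c * ((g₁ - maxwellian₁ lam f ε (g₁ + g₂)) ^ 2
          + (g₂ - maxwellian₂ lam f ε (g₁ + g₂)) ^ 2)

/-- On `[0, T]` the solution `(f₁, f₂)` takes its values where the kinetic entropy is defined. -/
def KineticEntropy.Carries {lam : ℝ} {f : ℝ → ℝ} {ε : ℝ} (E : KineticEntropy lam f ε) (T : ℝ)
    (f₁ f₂ : ℝ → ℝ → ℝ) : Prop :=
  ∀ t ∈ Icc 0 T, ∀ x, f₁ t x ∈ E.D₁ ∧ f₂ t x ∈ E.D₂ ∧ f₁ t x + f₂ t x ∈ E.J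

/-! ### Sobolev spaces and the limit equation -/

/-- `g` belongs to `L²(ℝ)` and its Bessel potential of order `σ` (the Fourier multiplier with
symbol `(1 + |ξ|²)^(σ/2)`) is `G ∈ L²(ℝ)`. -/
def HasBesselPotential (σ : ℝ) (g : ℝ → ℝ) (G : Lp ℂ 2 (volume : Measure ℝ)) : Prop :=
  ∃ hg : MemLp (fun x => (g x : ℂ)) 2 (volume : Measure ℝ),
    TemperedDistribution.besselPotential ℝ ℂ σ (hg.toLp _ : 𝓢'(ℝ, ℂ)) = (G : 𝓢'(ℝ, ℂ))

/-- `g ∈ H^σ(ℝ)` for a real-valued function `g` and `σ ≥ 0`. -/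
def InSobolev (σ : ℝ) (g : ℝ → ℝ) : Prop :=
  ∃ hg : MemLp (fun x => (g x : ℂ)) 2 (volume : Measure ℝ),
    TemperedDistribution.MemSobolev σ 2 (hg.toLp _ : 𝓢'(ℝ, ℂ))

/-- `u ∈ C([0, T]; H^σ(ℝ))`: the Bessel potentials of `u t` depend continuously on `t` in `L²`. -/
def ContinuousInSobolev (σ T : ℝ) (u : ℝ → ℝ → ℝ) : Prop :=
  ∃ G : ℝ → Lp ℂ 2 (volume : Measure ℝ), ContinuousOn G (Icc 0 T) ∧
    ∀ t ∈ Icc 0 T, HasBesselPotential σ (u t) (G t)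

/-- `ū` is a smooth solution on `[0, T] × ℝ` of `∂ₜ ū + ∂ₓ f(ū) = λ² ∂ₓₓ ū` with `ū(0) = u₀`:
it is of class `C^∞` for `0 < t < T` and lies in `C([0, T]; H^{s+1})`. For `s > 3/2` the space
`H^{s+1}` embeds in `C²`, and `contDiff_slice`, `cont`, `cont_deriv` only say that `ū t` is the
`C²` representative of its class. -/
structure IsSmoothSolution (lam : ℝ) (f : ℝ → ℝ) (s T : ℝ) (u₀ : ℝ → ℝ) (ubar : ℝ → ℝ → ℝ) :
    Prop where
  initial : ubar 0 = u₀
  sobolev : ContinuousInSobolev (s + 1) T ubar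
  contDiff_slice : ∀ t ∈ Icc 0 T, ContDiff ℝ 2 (ubar t)
  cont : ContinuousOn (Function.uncurry ubar) (Icc 0 T ×ˢ univ)
  cont_deriv : ContinuousOn (fun p : ℝ × ℝ => deriv (ubar p.1) p.2) (Icc 0 T ×ˢ univ)
  smooth : ContDiffOn ℝ ∞ (Function.uncurry ubar) (Ioo 0 T ×ˢ univ)
  eqn : ∀ t ∈ Ioo 0 T, ∀ x,
    deriv (fun τ => ubar τ x) t + deriv (fun y => f (ubar t y)) x
      = lam ^ 2 * iteratedDeriv 2 (ubar t) x

/-- The supremum of `|g|` over `[0, T] × ℝ`. -/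
noncomputable def stripSup (T : ℝ) (g : ℝ → ℝ → ℝ) : ℝ :=
  ⨆ p : Icc (0 : ℝ) T × ℝ, |g p.1 p.2|

/-! ### Square integrability of derivatives from Bessel potentials -/

section BesselPotential

open TemperedDistribution FourierTransform
open scoped LineDeriv Real BoundedContinuousFunction

/-- A Fourier multiplier with a bounded symbol is bounded on `L²`. -/
theorem exists_fourierMultiplier_eq_of_norm_le {g : ℝ → ℂ} (hg : g.HasTemperateGrowth) {C : ℝ}
    (hC0 : 0 ≤ C) (hC : ∀ x, ‖g x‖ ≤ C) (G : Lp ℂ 2 (volume : Measure ℝ)) :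
    ∃ H : Lp ℂ 2 (volume : Measure ℝ),
      fourierMultiplierCLM ℂ g (G : 𝓢'(ℝ, ℂ)) = (H : 𝓢'(ℝ, ℂ)) ∧ ‖H‖ ≤ C * ‖G‖ := by
  set g' : ℝ →ᵇ ℂ := BoundedContinuousFunction.ofNormedAddCommGroup g hg.1.continuous C hC
  set m : Lp ℂ ∞ (volume : Measure ℝ) := g'.memLp_top.toLp _ (μ := volume)
  refine ⟨𝓕⁻ (m • 𝓕 G : Lp ℂ 2 (volume : Measure ℝ)), ?_, ?_⟩
  · rw [fourierMultiplierCLM_apply, Lp.fourier_toTemperedDistribution_eq,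
      ← Lp.fourierInv_toTemperedDistribution_eq]
    congr 1
    exact (MeasureTheory.Lp.toTemperedDistribution_smul_eq (g := g') hg g'.memLp_top (𝓕 G)).symm
  · have h1 : ‖𝓕⁻ (m • 𝓕 G : Lp ℂ 2 (volume : Measure ℝ))‖ = ‖(m • 𝓕 G : Lp ℂ 2 _)‖ :=
      (Lp.fourierTransformₗᵢ ℝ ℂ).symm.norm_map _
    rw [h1]
    refine (Lp.norm_smul_le m (𝓕 G)).trans ?_
    rw [Lp.norm_fourier_eq]
    gcongr
    rw [Lp.norm_toLp]
    refine ENNReal.toReal_le_of_le_ofReal hC0 ?_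
    rw [eLpNorm_exponent_top]
    exact eLpNormEssSup_le_of_ae_bound (Eventually.of_forall hC)

theorem hasTemperateGrowth_bessel_symbol (σ : ℝ) :
    (fun ξ : ℝ => (((1 + ‖ξ‖ ^ 2) ^ (σ / 2) : ℝ) : ℂ)).HasTemperateGrowth := by
  fun_prop

theorem eq_fourierMultiplier_of_besselPotential {σ : ℝ} {T : 𝓢'(ℝ, ℂ)}
    {G : Lp ℂ 2 (volume : Measure ℝ)}
    (h : besselPotential ℝ ℂ σ T = (G : 𝓢'(ℝ, ℂ))) :
    T = fourierMultiplierCLM ℂ (fun ξ : ℝ => (((1 + ‖ξ‖ ^ 2) ^ (-σ / 2) : ℝ) : ℂ))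
      (G : 𝓢'(ℝ, ℂ)) :=
  ((besselPotential_neg_apply_eq_iff σ _ _).2 h).symm

/-- The first two derivatives of a distribution of Bessel order at least two are in `L²`. -/
theorem exists_lineDeriv_eq_of_besselPotential {σ : ℝ} (hσ : 2 ≤ σ) {T : 𝓢'(ℝ, ℂ)}
    {G : Lp ℂ 2 (volume : Measure ℝ)} (h : besselPotential ℝ ℂ σ T = (G : 𝓢'(ℝ, ℂ))) :
    ∃ H₀ H₁ H₂ : Lp ℂ 2 (volume : Measure ℝ),
      T = (H₀ : 𝓢'(ℝ, ℂ)) ∧ ∂_{(1 : ℝ)} T = (H₁ : 𝓢'(ℝ, ℂ)) ∧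
      ∂_{(1 : ℝ)} (∂_{(1 : ℝ)} T) = (H₂ : 𝓢'(ℝ, ℂ)) ∧
      ‖H₀‖ ≤ ‖G‖ ∧ ‖H₁‖ ≤ 2 * π * ‖G‖ ∧ ‖H₂‖ ≤ (2 * π) ^ 2 * ‖G‖ := by
  have hT := eq_fourierMultiplier_of_besselPotential h
  set b : ℝ → ℂ := fun ξ : ℝ => (((1 + ‖ξ‖ ^ 2) ^ (-σ / 2) : ℝ) : ℂ) with hb
  have hbg : b.HasTemperateGrowth := hasTemperateGrowth_bessel_symbol (-σ)
  set i : ℝ → ℂ := fun ξ : ℝ => ((inner ℝ ξ (1 : ℝ) : ℝ) : ℂ) with hi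
  have hig : i.HasTemperateGrowth := by fun_prop
  have hD : ∀ S : 𝓢'(ℝ, ℂ),
      ∂_{(1 : ℝ)} S = (2 * π * Complex.I) • fourierMultiplierCLM ℂ i S :=
    fun S => lineDeriv_eq_fourierMultiplierCLM 1 S
  have hbn : ∀ ξ : ℝ, ‖b ξ‖ ≤ (1 + ξ ^ 2)⁻¹ := by
    intro ξ
    have h1 : (1 : ℝ) ≤ 1 + ξ ^ 2 := by nlinarith [sq_nonneg ξ]
    rw [hb]
    simp only [Complex.norm_real, Real.norm_eq_abs, sq_abs]
    rw [abs_of_nonneg (by positivity), ← Real.rpow_neg_one]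
    exact Real.rpow_le_rpow_of_exponent_le h1 (by linarith)
  have hin : ∀ ξ : ℝ, ‖i ξ‖ = |ξ| := by
    intro ξ
    simp [hi]
  have hb1 : ∀ ξ, ‖b ξ‖ ≤ 1 := fun ξ => (hbn ξ).trans
    (inv_le_one_of_one_le₀ (by nlinarith [sq_nonneg ξ]))
  have hb2 : ∀ ξ, ‖(b * i) ξ‖ ≤ 1 := by
    intro ξ
    rw [Pi.mul_apply, norm_mul, hin]
    calc ‖b ξ‖ * |ξ| ≤ (1 + ξ ^ 2)⁻¹ * (1 + ξ ^ 2) := by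
          gcongr
          · exact hbn ξ
          · nlinarith [sq_nonneg (|ξ| - 1), sq_abs ξ]
      _ = 1 := inv_mul_cancel₀ (by positivity)
  have hb3 : ∀ ξ, ‖(b * i * i) ξ‖ ≤ 1 := by
    intro ξ
    rw [Pi.mul_apply, Pi.mul_apply, norm_mul, norm_mul, hin]
    calc ‖b ξ‖ * |ξ| * |ξ| = ‖b ξ‖ * ξ ^ 2 := by rw [mul_assoc, ← sq, sq_abs]
      _ ≤ (1 + ξ ^ 2)⁻¹ * (1 + ξ ^ 2) := by
          gcongr
          · exact hbn ξ
          · linarith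
      _ = 1 := inv_mul_cancel₀ (by positivity)
  obtain ⟨H₀, hH₀, hn₀⟩ := exists_fourierMultiplier_eq_of_norm_le hbg zero_le_one hb1 G
  obtain ⟨H₁, hH₁, hn₁⟩ :=
    exists_fourierMultiplier_eq_of_norm_le (hbg.mul hig) zero_le_one hb2 G
  obtain ⟨H₂, hH₂, hn₂⟩ :=
    exists_fourierMultiplier_eq_of_norm_le ((hbg.mul hig).mul hig) zero_le_one hb3 G
  have hc : ‖(2 * π * Complex.I : ℂ)‖ = 2 * π := by
    simp [abs_of_pos Real.pi_pos]
  have e1 : ∂_{(1 : ℝ)} T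
      = (2 * π * Complex.I) • fourierMultiplierCLM ℂ (b * i) (G : 𝓢'(ℝ, ℂ)) := by
    rw [hD, hT, fourierMultiplierCLM_fourierMultiplierCLM_apply hbg hig]
  have e2 : ∂_{(1 : ℝ)} (∂_{(1 : ℝ)} T)
      = (2 * π * Complex.I) ^ 2 • fourierMultiplierCLM ℂ (b * i * i) (G : 𝓢'(ℝ, ℂ)) := by
    rw [hD, e1, map_smul, fourierMultiplierCLM_fourierMultiplierCLM_apply (hbg.mul hig) hig,
      smul_smul, sq]
  refine ⟨H₀, (2 * π * Complex.I : ℂ) • H₁, (2 * π * Complex.I : ℂ) ^ 2 • H₂,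
    hT.trans hH₀, ?_, ?_, by simpa using hn₀, ?_, ?_⟩
  · rw [e1, hH₁]
    exact (map_smul (Lp.toTemperedDistributionCLM ℂ volume 2) _ H₁).symm
  · rw [e2, hH₂]
    exact (map_smul (Lp.toTemperedDistributionCLM ℂ volume 2) _ H₂).symm
  · rw [norm_smul, hc]
    rw [one_mul] at hn₁
    gcongr
  · rw [norm_smul, norm_pow, hc]
    rw [one_mul] at hn₂
    gcongr

theorem Lp_eq_of_toTemperedDistribution_eq {G H : Lp ℂ 2 (volume : Measure ℝ)}
    (h : (G : 𝓢'(ℝ, ℂ)) = (H : 𝓢'(ℝ, ℂ))) : G = H :=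
  LinearMap.ker_eq_bot.1 (Lp.ker_toTemperedDistributionCLM_eq_bot (F := ℂ)
    (μ := (volume : Measure ℝ)) (p := 2)) h

/-- If the distributional derivative of a `C¹` function is in `L²`, it is the classical one. -/
theorem memLp_deriv_of_lineDeriv_eq {g : ℝ → ℝ} (hg : ContDiff ℝ 1 g)
    (hg2 : MemLp (fun x => (g x : ℂ)) 2 (volume : Measure ℝ)) {H : Lp ℂ 2 (volume : Measure ℝ)}
    (h : ∂_{(1 : ℝ)} (hg2.toLp _ : 𝓢'(ℝ, ℂ)) = (H : 𝓢'(ℝ, ℂ))) :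
    ∃ hd : MemLp (fun x => ((deriv g x : ℝ) : ℂ)) 2 (volume : Measure ℝ), hd.toLp _ = H := by
  have hcont : Continuous (fun x => ((deriv g x : ℝ) : ℂ)) :=
    Complex.continuous_ofReal.comp (hg.continuous_deriv le_rfl)
  have hgc : Continuous (fun x => (g x : ℂ)) := Complex.continuous_ofReal.comp hg.continuous
  have hgd : ∀ x, HasDerivAt (fun x => (g x : ℂ)) ((deriv g x : ℝ) : ℂ) x := fun x =>
    ((hg.differentiable one_ne_zero x).hasDerivAt).ofReal_comp
  have hae : (fun x => ((deriv g x : ℝ) : ℂ)) =ᵐ[volume] H := by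
    apply ae_eq_of_integral_contDiff_smul_eq hcont.locallyIntegrable
      ((Lp.memLp H).locallyIntegrable (by norm_num))
    intro ψ hψ hψc
    have hψC : ContDiff ℝ ∞ (fun x => (ψ x : ℂ)) := Complex.ofRealCLM.contDiff.comp hψ
    have hψCc : HasCompactSupport (fun x => (ψ x : ℂ)) :=
      hψc.comp_left (g := fun y : ℝ => (y : ℂ)) (by simp)
    have hψd : ∀ x, HasDerivAt (fun x => (ψ x : ℂ)) ((deriv ψ x : ℝ) : ℂ) x := fun x =>
      ((hψ.differentiable (by simp) x).hasDerivAt).ofReal_comp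
    have hψdc : Continuous (deriv ψ) := hψ.continuous_deriv (by simp)
    have hψds : HasCompactSupport (fun x => ((deriv ψ x : ℝ) : ℂ)) :=
      hψc.deriv.comp_left (g := fun y : ℝ => (y : ℂ)) (by simp)
    set S : 𝓢(ℝ, ℂ) := hψCc.toSchwartzMap hψC with hS
    have hSx : ∀ x, S x = (ψ x : ℂ) := fun x => rfl
    have hdS : ∀ x, (∂_{(1 : ℝ)} S) x = ((deriv ψ x : ℝ) : ℂ) := by
      intro x
      rw [SchwartzMap.lineDerivOp_apply_eq_fderiv]
      have : fderiv ℝ (⇑S) x (1 : ℝ) = deriv (fun x => (ψ x : ℂ)) x := fderiv_apply_one_eq_deriv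
      rw [this]
      exact (hψd x).deriv
    have key := DFunLike.congr_fun h S
    rw [lineDerivOp_apply_apply, Lp.toTemperedDistribution_apply,
      Lp.toTemperedDistribution_apply] at key
    have e1 : (∫ x, ψ x • (H : ℝ → ℂ) x) = ∫ x, S x • (H : ℝ → ℂ) x := by
      refine integral_congr_ae (Eventually.of_forall fun x => ?_)
      simp [hSx]
    have e2 : (∫ x, (-∂_{(1 : ℝ)} S) x • (hg2.toLp _ : ℝ → ℂ) x)
        = - ∫ x, (fun x => (g x : ℂ)) x * ((deriv ψ x : ℝ) : ℂ) := by
      rw [← integral_neg]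
      refine integral_congr_ae ?_
      filter_upwards [hg2.coeFn_toLp] with x hx
      rw [hx, neg_apply, hdS, smul_eq_mul]
      ring
    rw [e1, ← key, e2, integral_mul_deriv_eq_deriv_mul_of_integrable
      (u := fun x => (g x : ℂ)) (v := fun x => (ψ x : ℂ))
      (u' := fun x => ((deriv g x : ℝ) : ℂ)) (fun x _ => hgd x) (fun x _ => hψd x)
      ((hgc.mul (Complex.continuous_ofReal.comp hψdc)).integrable_of_hasCompactSupport
        hψds.mul_left)
      ((hcont.mul hψC.continuous).integrable_of_hasCompactSupport hψCc.mul_left)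
      ((hgc.mul hψC.continuous).integrable_of_hasCompactSupport hψCc.mul_left), neg_neg]
    refine integral_congr_ae (Eventually.of_forall fun x => ?_)
    simp [mul_comm]
  have hd : MemLp (fun x => ((deriv g x : ℝ) : ℂ)) 2 (volume : Measure ℝ) :=
    (memLp_congr_ae hae).2 (Lp.memLp H)
  exact ⟨hd, Lp.ext (hd.coeFn_toLp.trans hae)⟩

theorem integrable_sq_of_memLp_ofReal {g : ℝ → ℝ}
    (hg : MemLp (fun x => (g x : ℂ)) 2 (volume : Measure ℝ)) :
    Integrable (fun x => g x ^ 2) ∧ ∫ x, g x ^ 2 = ‖hg.toLp _‖ ^ 2 := by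
  have h1 : Integrable (fun x => g x ^ 2) := by
    have := hg.integrable_norm_pow (by norm_num)
    simpa using this
  refine ⟨h1, ?_⟩
  rw [← inner_self_eq_norm_sq (𝕜 := ℂ), L2.inner_def, ← integral_re]
  · refine integral_congr_ae ?_
    filter_upwards [hg.coeFn_toLp] with x hx
    rw [hx]
    simp [sq]
  · exact L2.integrable_inner _ _

/-- A `C²` function of Bessel order at least two is in `L²` together with its first two
derivatives. -/
theorem integral_sq_le_of_hasBesselPotential {σ : ℝ} (hσ : 2 ≤ σ) {g : ℝ → ℝ}
    (hg : ContDiff ℝ 2 g) {G : Lp ℂ 2 (volume : Measure ℝ)} (h : HasBesselPotential σ g G) :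
    (Integrable (fun x => g x ^ 2) ∧ ∫ x, g x ^ 2 ≤ (2 * π) ^ 4 * ‖G‖ ^ 2) ∧
    (Integrable (fun x => deriv g x ^ 2) ∧ ∫ x, deriv g x ^ 2 ≤ (2 * π) ^ 4 * ‖G‖ ^ 2) ∧
    (Integrable (fun x => deriv (deriv g) x ^ 2) ∧
      ∫ x, deriv (deriv g) x ^ 2 ≤ (2 * π) ^ 4 * ‖G‖ ^ 2) := by
  obtain ⟨h0, hT⟩ := h
  obtain ⟨H₀, H₁, H₂, e0, e1, e2, n0, n1, n2⟩ := exists_lineDeriv_eq_of_besselPotential hσ hT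
  have hπ : (1 : ℝ) ≤ 2 * π := by linarith [Real.pi_gt_three]
  have hg' : ContDiff ℝ 1 (deriv g) := by
    have : ContDiff ℝ (1 + 1) g := by simpa [one_add_one_eq_two] using hg
    exact ((contDiff_succ_iff_deriv).1 this).2.2
  obtain ⟨h1, rfl⟩ := memLp_deriv_of_lineDeriv_eq (hg.of_le (by norm_num)) h0 e1
  rw [e1] at e2
  obtain ⟨h2, rfl⟩ := memLp_deriv_of_lineDeriv_eq hg' h1 e2
  have e0' := Lp_eq_of_toTemperedDistribution_eq e0
  subst e0'
  have aux : ∀ {a c : ℝ}, 0 ≤ a → a ≤ c * ‖G‖ → c ≤ (2 * π) ^ 2 → a ^ 2 ≤ (2 * π) ^ 4 * ‖G‖ ^ 2 := by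
    intro a c ha hac hc
    have : a ≤ (2 * π) ^ 2 * ‖G‖ := hac.trans (by gcongr)
    calc a ^ 2 ≤ ((2 * π) ^ 2 * ‖G‖) ^ 2 := by gcongr
      _ = _ := by ring
  obtain ⟨i0, j0⟩ := integrable_sq_of_memLp_ofReal h0
  obtain ⟨i1, j1⟩ := integrable_sq_of_memLp_ofReal h1
  obtain ⟨i2, j2⟩ := integrable_sq_of_memLp_ofReal h2
  refine ⟨⟨i0, ?_⟩, ⟨i1, ?_⟩, ⟨i2, ?_⟩⟩
  · rw [j0]; exact aux (norm_nonneg _) (by simpa using n0) (c := 1) (one_le_pow₀ hπ)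
  · rw [j1]; exact aux (norm_nonneg _) n1 (by nlinarith)
  · rw [j2]; exact aux (norm_nonneg _) n2 le_rfl

theorem HasBesselPotential.unique {σ : ℝ} {g : ℝ → ℝ} {G H : Lp ℂ 2 (volume : Measure ℝ)}
    (hG : HasBesselPotential σ g G) (hH : HasBesselPotential σ g H) : G = H := by
  obtain ⟨_, h1⟩ := hG
  obtain ⟨_, h2⟩ := hH
  exact Lp_eq_of_toTemperedDistribution_eq (h1.symm.trans h2)

/-- The one-dimensional Sobolev inequality. -/
theorem sq_le_integral_sq_add_integral_deriv_sq {g : ℝ → ℝ} (hg : ContDiff ℝ 1 g)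
    (h0 : Integrable (fun x => g x ^ 2)) (h1 : Integrable (fun x => deriv g x ^ 2)) (x : ℝ) :
    g x ^ 2 ≤ (∫ y, g y ^ 2) + ∫ y, deriv g y ^ 2 := by
  have hd : ∀ y, HasDerivAt (fun y => g y ^ 2) (2 * g y * deriv g y) y := by
    intro y
    simpa using ((hg.differentiable one_ne_zero y).hasDerivAt).fun_pow 2
  have hi : Integrable (fun y => 2 * g y * deriv g y) := by
    refine (h0.add h1).mono' ?_ (Eventually.of_forall fun y => ?_)
    · exact ((continuous_const.mul hg.continuous).mul
        (hg.continuous_deriv le_rfl)).aestronglyMeasurable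
    · simp only [Real.norm_eq_abs, Pi.add_apply]
      rw [abs_le]
      constructor <;> nlinarith [sq_nonneg (g y + deriv g y), sq_nonneg (g y - deriv g y)]
  have ht : Tendsto (fun y => g y ^ 2) atBot (𝓝 0) :=
    tendsto_zero_of_hasDerivAt_of_integrableOn_Iic (a := x) (fun y _ => hd y)
      hi.integrableOn h0.integrableOn
  have h2 := integral_Iic_of_hasDerivAt_of_tendsto' (a := x) (fun y _ => hd y) hi.integrableOn ht
  rw [sub_zero] at h2
  rw [← h2, ← integral_add h0 h1]
  calc ∫ y in Iic x, 2 * g y * deriv g y ≤ ∫ y in Iic x, (g y ^ 2 + deriv g y ^ 2) := by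
        refine integral_mono hi.integrableOn (h0.add h1).integrableOn fun y => ?_
        nlinarith [sq_nonneg (g y - deriv g y)]
    _ ≤ ∫ y, (g y ^ 2 + deriv g y ^ 2) :=
        setIntegral_le_integral (h0.add h1) (Eventually.of_forall fun y => by positivity)

end BesselPotential

/-! ### Partial derivatives on an open strip -/

section Strip

/-- The partial derivative in the first variable. -/
noncomputable def dt (F : ℝ × ℝ → ℝ) (p : ℝ × ℝ) : ℝ := fderiv ℝ F p (1, 0)

/-- The partial derivative in the second variable. -/
noncomputable def dx (F : ℝ × ℝ → ℝ) (p : ℝ × ℝ) : ℝ := fderiv ℝ F p (0, 1)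

/-- The open strip `(0, T) × ℝ`. -/
abbrev openStrip (T : ℝ) : Set (ℝ × ℝ) := Ioo 0 T ×ˢ univ

variable {T : ℝ} {F G : ℝ × ℝ → ℝ}

theorem isOpen_openStrip (T : ℝ) : IsOpen (openStrip T) := isOpen_Ioo.prod isOpen_univ

theorem openStrip_mem_nhds {p : ℝ × ℝ} (hp : p ∈ openStrip T) : openStrip T ∈ 𝓝 p :=
  (isOpen_openStrip T).mem_nhds hp

theorem mk_mem_openStrip {t : ℝ} (ht : t ∈ Ioo 0 T) (x : ℝ) : (t, x) ∈ openStrip T :=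
  ⟨ht, mem_univ x⟩

theorem hasDerivAt_dt (hF : ContDiffOn ℝ 1 F (openStrip T)) {t : ℝ} (ht : t ∈ Ioo 0 T) (x : ℝ) :
    HasDerivAt (fun τ => F (τ, x)) (dt F (t, x)) t := by
  have h1 : HasFDerivAt F (fderiv ℝ F (t, x)) (t, x) :=
    ((hF.contDiffAt (openStrip_mem_nhds (mk_mem_openStrip ht x))).differentiableAt
      one_ne_zero).hasFDerivAt
  have h2 : HasDerivAt (fun τ : ℝ => (τ, x)) ((1 : ℝ), (0 : ℝ)) t :=
    (hasDerivAt_id t).prodMk (hasDerivAt_const t x)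
  exact h1.comp_hasDerivAt t h2

theorem hasDerivAt_dx (hF : ContDiffOn ℝ 1 F (openStrip T)) {t : ℝ} (ht : t ∈ Ioo 0 T) (x : ℝ) :
    HasDerivAt (fun y => F (t, y)) (dx F (t, x)) x := by
  have h1 : HasFDerivAt F (fderiv ℝ F (t, x)) (t, x) :=
    ((hF.contDiffAt (openStrip_mem_nhds (mk_mem_openStrip ht x))).differentiableAt
      one_ne_zero).hasFDerivAt
  have h2 : HasDerivAt (fun y : ℝ => (t, y)) ((0 : ℝ), (1 : ℝ)) x :=
    (hasDerivAt_const x t).prodMk (hasDerivAt_id x)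
  exact h1.comp_hasDerivAt x h2

theorem continuousOn_dt (hF : ContDiffOn ℝ 1 F (openStrip T)) :
    ContinuousOn (dt F) (openStrip T) :=
  (hF.continuousOn_fderiv_of_isOpen (isOpen_openStrip T) le_rfl).clm_apply continuousOn_const

theorem continuousOn_dx (hF : ContDiffOn ℝ 1 F (openStrip T)) :
    ContinuousOn (dx F) (openStrip T) :=
  (hF.continuousOn_fderiv_of_isOpen (isOpen_openStrip T) le_rfl).clm_apply continuousOn_const

theorem contDiffOn_dt (hF : ContDiffOn ℝ ∞ F (openStrip T)) :
    ContDiffOn ℝ ∞ (dt F) (openStrip T) :=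
  (hF.fderiv_of_isOpen (isOpen_openStrip T) (by simp)).clm_apply contDiffOn_const

theorem contDiffOn_dx (hF : ContDiffOn ℝ ∞ F (openStrip T)) :
    ContDiffOn ℝ ∞ (dx F) (openStrip T) :=
  (hF.fderiv_of_isOpen (isOpen_openStrip T) (by simp)).clm_apply contDiffOn_const

theorem dt_dx_comm (hF : ContDiffOn ℝ ∞ F (openStrip T)) {p : ℝ × ℝ} (hp : p ∈ openStrip T) :
    dt (dx F) p = dx (dt F) p := by
  have hc : ContDiffAt ℝ ∞ F p := hF.contDiffAt (openStrip_mem_nhds hp)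
  have hd : DifferentiableAt ℝ (fderiv ℝ F) p :=
    (hc.fderiv_right (m := ∞) (by simp)).differentiableAt (by simp)
  have hs : IsSymmSndFDerivAt ℝ F p :=
    hc.isSymmSndFDerivAt (by
      rw [minSmoothness_of_isRCLikeNormedField]
      exact WithTop.coe_le_coe.2 (le_top (a := (2 : ℕ∞))))
  have e : ∀ a b : ℝ × ℝ, fderiv ℝ (fun q => fderiv ℝ F q a) p b = fderiv ℝ (fderiv ℝ F) p b a := by
    intro a b
    rw [fderiv_clm_apply hd (differentiableAt_const a)]
    simp
  change fderiv ℝ (fun q => fderiv ℝ F q (0, 1)) p (1, 0)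
    = fderiv ℝ (fun q => fderiv ℝ F q (1, 0)) p (0, 1)
  rw [e, e]
  exact hs (1, 0) (0, 1)

theorem dt_congr (h : EqOn F G (openStrip T)) {p : ℝ × ℝ} (hp : p ∈ openStrip T) :
    dt F p = dt G p := by
  have : F =ᶠ[𝓝 p] G := eventually_of_mem (openStrip_mem_nhds hp) h
  rw [dt, dt, this.fderiv_eq]

theorem continuous_slice (hF : ContinuousOn F (openStrip T)) {t : ℝ} (ht : t ∈ Ioo 0 T) :
    Continuous fun x => F (t, x) :=
  hF.comp_continuous (by fun_prop) fun x => mk_mem_openStrip ht x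

/-- Differentiation under the integral sign over a bounded interval. -/
theorem hasDerivAt_integral_strip (hF : ContDiffOn ℝ 1 F (openStrip T)) (a b : ℝ) {t : ℝ}
    (ht : t ∈ Ioo 0 T) :
    HasDerivAt (fun τ => ∫ x in a..b, F (τ, x)) (∫ x in a..b, dt F (t, x)) t := by
  obtain ⟨δ, hδ, hball⟩ := Metric.nhds_basis_closedBall.mem_iff.1 (isOpen_Ioo.mem_nhds ht)
  have hK : IsCompact (Metric.closedBall t δ ×ˢ uIcc a b) :=
    (isCompact_closedBall t δ).prod isCompact_uIcc
  have hsub : Metric.closedBall t δ ×ˢ uIcc a b ⊆ openStrip T := prod_mono hball (subset_univ _)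
  obtain ⟨C, hC⟩ := hK.exists_bound_of_continuousOn ((continuousOn_dt hF).mono hsub)
  refine (intervalIntegral.hasDerivAt_integral_of_dominated_loc_of_deriv_le
    (F := fun τ x => F (τ, x)) (F' := fun τ x => dt F (τ, x)) (bound := fun _ => C)
    (Metric.closedBall_mem_nhds t hδ) ?_ ?_ ?_ ?_ ?_ ?_).2
  · filter_upwards [isOpen_Ioo.mem_nhds ht] with τ hτ
    exact (continuous_slice hF.continuousOn hτ).aestronglyMeasurable
  · exact (continuous_slice hF.continuousOn ht).intervalIntegrable _ _
  · exact (continuous_slice (continuousOn_dt hF) ht).aestronglyMeasurable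
  · exact Eventually.of_forall fun x hx τ hτ => hC (τ, x) ⟨hτ, uIoc_subset_uIcc hx⟩
  · exact intervalIntegrable_const
  · exact Eventually.of_forall fun x _ τ hτ => hasDerivAt_dt hF (hball hτ) x

/-- A balance law with a flux that vanishes at both ends of the interval. -/
theorem hasDerivAt_integral_balance (hF : ContDiffOn ℝ 1 F (openStrip T))
    (hG : ContDiffOn ℝ 1 G (openStrip T)) {a b : ℝ} {t : ℝ} (ht : t ∈ Ioo 0 T)
    (ha : G (t, a) = 0) (hb : G (t, b) = 0) :
    HasDerivAt (fun τ => ∫ x in a..b, F (τ, x)) (∫ x in a..b, (dt F (t, x) + dx G (t, x))) t := by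
  have hGc : Continuous fun x => dx G (t, x) := continuous_slice (continuousOn_dx hG) ht
  have h1 : ∫ x in a..b, dx G (t, x) = 0 := by
    rw [intervalIntegral.integral_eq_sub_of_hasDerivAt (f := fun x => G (t, x))
      (fun x _ => hasDerivAt_dx hG ht x) (hGc.intervalIntegrable _ _), ha, hb, sub_zero]
  rw [intervalIntegral.integral_add
    ((continuous_slice (continuousOn_dt hF) ht).intervalIntegrable _ _)
    (hGc.intervalIntegrable _ _), h1, add_zero]
  exact hasDerivAt_integral_strip hF a b ht

end Strip

/-- Grönwall's inequality for a linear differential inequality on an open interval. -/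
theorem le_exp_mul_of_hasDerivAt_le {T k D : ℝ} (hk : 0 ≤ k) (hD : 0 ≤ D) {y y' : ℝ → ℝ}
    (hy : ∀ t ∈ Ioo 0 T, HasDerivAt y (y' t) t) (hle : ∀ t ∈ Ioo 0 T, y' t ≤ k * y t + D)
    {t₀ t₁ : ℝ} (h0 : 0 < t₀) (h01 : t₀ ≤ t₁) (h1 : t₁ < T) :
    y t₁ ≤ Real.exp (k * (t₁ - t₀)) * (y t₀ + D * (t₁ - t₀)) := by
  set g : ℝ → ℝ := fun t => Real.exp (-(k * (t - t₀))) * y t - D * (t - t₀) with hg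
  have hsub : ∀ t ∈ Icc t₀ t₁, t ∈ Ioo 0 T := fun t ht =>
    ⟨h0.trans_le ht.1, ht.2.trans_lt h1⟩
  have hgd : ∀ t ∈ Icc t₀ t₁, HasDerivAt g
      (Real.exp (-(k * (t - t₀))) * (-k) * y t + Real.exp (-(k * (t - t₀))) * y' t - D) t := by
    intro t ht
    have e1 : HasDerivAt (fun t => -(k * (t - t₀))) (-k) t := by
      simpa using (((hasDerivAt_id t).sub_const t₀).const_mul k).fun_neg
    have e2 : HasDerivAt (fun t => D * (t - t₀)) D t := by
      simpa using ((hasDerivAt_id t).sub_const t₀).const_mul D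
    exact (e1.exp.mul (hy t (hsub t ht))).sub e2
  have hanti : AntitoneOn g (Icc t₀ t₁) := by
    refine antitoneOn_of_deriv_nonpos (convex_Icc _ _)
      (fun t ht => (hgd t ht).continuousAt.continuousWithinAt)
      (fun t ht => (hgd t (interior_subset ht)).differentiableAt.differentiableWithinAt)
      fun t ht => ?_
    have ht' := interior_subset ht
    rw [(hgd t ht').deriv]
    have h2 := hle t (hsub t ht')
    have h3 : Real.exp (-(k * (t - t₀))) ≤ 1 :=
      Real.exp_le_one_iff.2 (neg_nonpos.2 (mul_nonneg hk (sub_nonneg.2 ht'.1)))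
    have h4 := Real.exp_pos (-(k * (t - t₀)))
    nlinarith [mul_le_mul_of_nonneg_left h2 h4.le, mul_le_mul_of_nonneg_right h3 hD]
  have h5 := hanti (left_mem_Icc.2 h01) (right_mem_Icc.2 h01) h01
  simp only [hg, sub_self, mul_zero, neg_zero, Real.exp_zero, one_mul, sub_zero] at h5
  have h6 : Real.exp (-(k * (t₁ - t₀))) * y t₁ ≤ y t₀ + D * (t₁ - t₀) := by linarith
  calc y t₁ = Real.exp (k * (t₁ - t₀)) * (Real.exp (-(k * (t₁ - t₀))) * y t₁) := by
        rw [← mul_assoc, ← Real.exp_add]; simp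
    _ ≤ _ := by gcongr

/-! ### A cutoff adapted to the finite speed of propagation -/

section Cutoff

theorem exists_abs_deriv_smoothTransition_le :
    ∃ κ : ℝ, 0 ≤ κ ∧ ∀ y, |deriv Real.smoothTransition y| ≤ κ := by
  have hc : Continuous (deriv Real.smoothTransition) :=
    (Real.smoothTransition.contDiff (n := 1)).continuous_deriv (by norm_num)
  obtain ⟨κ, hκ⟩ := isCompact_Icc.exists_bound_of_continuousOn (s := Icc (0 : ℝ) 1) hc.continuousOn
  have hκ0 : 0 ≤ κ := (norm_nonneg _).trans (hκ 0 (by simp))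
  refine ⟨κ, hκ0, fun y => ?_⟩
  rcases lt_or_ge y 0 with hy | hy
  · have : Real.smoothTransition =ᶠ[𝓝 y] fun _ => 0 := by
      filter_upwards [isOpen_Iio.mem_nhds hy] with u hu
      exact Real.smoothTransition.zero_of_nonpos (le_of_lt hu)
    rw [this.deriv_eq]
    simpa using hκ0
  rcases le_or_gt y 1 with hy1 | hy1
  · exact hκ y ⟨hy, hy1⟩
  · have : Real.smoothTransition =ᶠ[𝓝 y] fun _ => 1 := by
      filter_upwards [isOpen_Ioi.mem_nhds hy1] with u hu
      exact Real.smoothTransition.one_of_one_le (le_of_lt hu)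
    rw [this.deriv_eq]
    simpa using hκ0

/-- A cutoff at scale `N` whose level sets move inwards with speed at least `c`. -/
noncomputable def coneCutoff (c N : ℝ) (p : ℝ × ℝ) : ℝ :=
  Real.smoothTransition (2 - (√(1 + p.2 ^ 2) + c * p.1) / N)

variable {c N : ℝ}

theorem contDiff_coneCutoff : ContDiff ℝ 1 (coneCutoff c N) := by
  refine (Real.smoothTransition.contDiff (n := 1)).comp ?_
  have h : ContDiff ℝ 1 fun p : ℝ × ℝ => √(1 + p.2 ^ 2) :=
    (contDiff_const.add (contDiff_snd.pow 2)).sqrt fun p => by positivity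
  exact contDiff_const.sub ((h.add (contDiff_const.mul contDiff_fst)).div_const N)

theorem coneCutoff_nonneg (p : ℝ × ℝ) : 0 ≤ coneCutoff c N p := Real.smoothTransition.nonneg _

theorem coneCutoff_le_one (p : ℝ × ℝ) : coneCutoff c N p ≤ 1 := Real.smoothTransition.le_one _

theorem coneCutoff_eq_zero (hc : 0 ≤ c) (hN : 0 < N) {t x : ℝ} (ht : 0 ≤ t) (hx : 2 * N ≤ |x|) :
    coneCutoff c N (t, x) = 0 := by
  refine Real.smoothTransition.zero_of_nonpos ?_
  have h1 : |x| ≤ √(1 + x ^ 2) := Real.abs_le_sqrt (by linarith)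
  have h2 : 0 ≤ c * t := mul_nonneg hc ht
  rw [sub_nonpos, le_div_iff₀ hN]
  dsimp only
  linarith

theorem coneCutoff_eq_one (hN : 0 < N) {t x : ℝ} (h : 1 + |x| + c * t ≤ N) :
    coneCutoff c N (t, x) = 1 := by
  refine Real.smoothTransition.one_of_one_le ?_
  have h1 : √(1 + x ^ 2) ≤ 1 + |x| := by
    refine Real.sqrt_le_iff.2 ⟨by positivity, ?_⟩
    nlinarith [abs_nonneg x, sq_abs x]
  have : (√(1 + x ^ 2) + c * t) / N ≤ 1 := by
    rw [div_le_one hN]; linarith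
  dsimp only
  linarith

/-- The partial derivatives of the cutoff. -/
theorem exists_hasDerivAt_coneCutoff {κ : ℝ} (hκ : ∀ y, |deriv Real.smoothTransition y| ≤ κ)
    (hc : 0 ≤ c) (hN : 0 < N) (t x : ℝ) :
    ∃ ψt ψx : ℝ, HasDerivAt (fun τ => coneCutoff c N (τ, x)) ψt t ∧
      HasDerivAt (fun y => coneCutoff c N (t, y)) ψx x ∧ ψt ≤ -c * |ψx| ∧ |ψx| ≤ κ / N := by
  set y := 2 - (√(1 + x ^ 2) + c * t) / N with hy
  have hs : HasDerivAt Real.smoothTransition (deriv Real.smoothTransition y) y :=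
    ((Real.smoothTransition.contDiff (n := 1)).differentiable (by norm_num) y).hasDerivAt
  have hs0 : 0 ≤ deriv Real.smoothTransition y := Real.smoothTransition.monotone.deriv_nonneg
  have hpos : (0 : ℝ) < 1 + x ^ 2 := by positivity
  have hr : HasDerivAt (fun y : ℝ => √(1 + y ^ 2)) (x / √(1 + x ^ 2)) x := by
    have h := (((hasDerivAt_id x).fun_pow 2).const_add 1).sqrt hpos.ne'
    refine h.congr_deriv ?_
    simp only [id, Nat.cast_ofNat, mul_one]
    rw [show (2 : ℕ) - 1 = 1 from rfl, pow_one, mul_div_mul_left _ _ two_ne_zero]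
  have h1 : HasDerivAt (fun τ => 2 - (√(1 + x ^ 2) + c * τ) / N) (-(c / N)) t := by
    have := ((((hasDerivAt_id t).const_mul c).const_add (√(1 + x ^ 2))).div_const N).const_sub 2
    simpa using this
  have h2 : HasDerivAt (fun y => 2 - (√(1 + y ^ 2) + c * t) / N) (-(x / √(1 + x ^ 2) / N)) x :=
    ((hr.add_const (c * t)).div_const N).const_sub 2
  have hx1 : |x / √(1 + x ^ 2)| ≤ 1 := by
    rw [abs_div, abs_of_pos (Real.sqrt_pos.2 hpos), div_le_one (Real.sqrt_pos.2 hpos)]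
    exact Real.abs_le_sqrt (by linarith)
  refine ⟨_, _, hs.comp t h1, hs.comp x h2, ?_, ?_⟩
  · rw [abs_mul, abs_of_nonneg hs0, abs_neg, abs_div, abs_of_pos hN]
    have : c * (deriv Real.smoothTransition y * (|x / √(1 + x ^ 2)| / N))
        ≤ c * (deriv Real.smoothTransition y * (1 / N)) := by gcongr
    calc deriv Real.smoothTransition y * -(c / N)
        = -(c * (deriv Real.smoothTransition y * (1 / N))) := by ring
      _ ≤ _ := by linarith
  · rw [abs_mul, abs_neg, abs_div, abs_of_pos hN]
    calc |deriv Real.smoothTransition y| * (|x / √(1 + x ^ 2)| / N) ≤ κ * (1 / N) := by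
          gcongr
          · exact (abs_nonneg _).trans (hκ 0)
          · exact hκ y
      _ = κ / N := by ring

end Cutoff

/-! ### The localized relative energy -/

section Energy

theorem cutoff_transport_nonpos {lam ε w z ψt ψx e : ℝ} (hlam : 0 < lam) (hε : 0 < ε)
    (hψt : ψt ≤ -(lam / ε) * |ψx|) (he : 0 ≤ e) :
    ψt * (lam ^ 2 * w ^ 2 / 2 + ε ^ 2 * z ^ 2 / 2 + e) + ψx * (lam ^ 2 * w * z) ≤ 0 := by
  have c0 : 0 < lam / ε := by positivity
  have hψt0 : ψt ≤ 0 := hψt.trans (by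
    rw [neg_mul]; exact neg_nonpos.2 (mul_nonneg c0.le (abs_nonneg _)))
  obtain ⟨e0, he0⟩ : ∃ e0, e0 = lam ^ 2 * w ^ 2 / 2 + ε ^ 2 * z ^ 2 / 2 := ⟨_, rfl⟩
  have he0' : 0 ≤ e0 := by rw [he0]; positivity
  have b0 : lam * ε * |w * z| ≤ e0 := by
    rw [he0, abs_mul]
    have := sq_nonneg (lam * |w| - ε * |z|)
    have e1 := sq_abs w
    have e2 := sq_abs z
    rw [← e1, ← e2]
    linarith
  have b1 : |lam ^ 2 * w * z| ≤ lam / ε * e0 := by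
    calc |lam ^ 2 * w * z| = lam / ε * (lam * ε * |w * z|) := by
          rw [mul_assoc, abs_mul, abs_of_pos (by positivity : 0 < lam ^ 2)]
          field_simp
      _ ≤ _ := by gcongr
  have b2 : ψx * (lam ^ 2 * w * z) ≤ |ψx| * (lam / ε * e0) :=
    (le_abs_self _).trans (by rw [abs_mul]; gcongr)
  have b3 : ψt * e0 ≤ -(lam / ε) * |ψx| * e0 := mul_le_mul_of_nonneg_right hψt he0'
  have b4 : ψt * e ≤ 0 := mul_nonpos_of_nonpos_of_nonneg hψt0 he
  rw [← he0]
  linarith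

/-- Dissipation of the relative energy, multiplied by the square of a cutoff. -/
theorem cutoff_energy_dissipation {lam ε L m w wt wx z zt zx p pt px r rx d b ψ ψt ψx : ℝ}
    (hlam : 0 < lam) (hε : 0 < ε) (hψ : 0 ≤ ψ) (hψt : ψt ≤ -(lam / ε) * |ψx|) (hψx : |ψx| ≤ m)
    (h1 : wt = -zx) (h2 : ε ^ 2 * zt = -lam ^ 2 * wx - z + d - ε ^ 2 * r) (h3 : pt = rx)
    (h4 : lam ^ 2 * px = r + b * p) (hd : |d| ≤ L * |w|) (hb : |b| ≤ L) :
    2 * ψ * ψt * (lam ^ 2 * w ^ 2 / 2 + ε ^ 2 * z ^ 2 / 2 + ε ^ 4 * lam ^ 2 * p ^ 2 / 2)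
      + ψ ^ 2 * (lam ^ 2 * w * wt + ε ^ 2 * z * zt + ε ^ 4 * lam ^ 2 * p * pt)
      + (2 * ψ * ψx * (lam ^ 2 * w * z - ε ^ 4 * lam ^ 2 * p * r)
        + ψ ^ 2 * (lam ^ 2 * (wx * z + w * zx) - ε ^ 4 * lam ^ 2 * (px * r + p * rx)))
      ≤ 2 * L ^ 2 / lam ^ 2 *
          (ψ ^ 2 * (lam ^ 2 * w ^ 2 / 2 + ε ^ 2 * z ^ 2 / 2 + ε ^ 4 * lam ^ 2 * p ^ 2 / 2))
        + 4 * ε ^ 4 * lam ^ 4 * m ^ 2 * p ^ 2 := by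
  have hL : 0 ≤ L := (abs_nonneg b).trans hb
  have s1 : lam ^ 2 * w * wt + ε ^ 2 * z * zt + ε ^ 4 * lam ^ 2 * p * pt
      + (lam ^ 2 * (wx * z + w * zx) - ε ^ 4 * lam ^ 2 * (px * r + p * rx))
      = z * d - z ^ 2 - ε ^ 2 * z * r - ε ^ 4 * (r + b * p) * r := by
    rw [h1, h3]
    linear_combination z * h2 - ε ^ 4 * r * h4
  have hd2 : d ^ 2 ≤ L ^ 2 * w ^ 2 := by
    calc d ^ 2 = |d| ^ 2 := (sq_abs d).symm
      _ ≤ (L * |w|) ^ 2 := by gcongr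
      _ = L ^ 2 * w ^ 2 := by rw [mul_pow, sq_abs]
  have hb2 : b ^ 2 ≤ L ^ 2 := by
    calc b ^ 2 = |b| ^ 2 := (sq_abs b).symm
      _ ≤ L ^ 2 := by gcongr
  have s2 : z * d - z ^ 2 - ε ^ 2 * z * r - ε ^ 4 * (r + b * p) * r
      ≤ L ^ 2 * w ^ 2 / 2 + ε ^ 4 * L ^ 2 * p ^ 2 - ε ^ 4 * r ^ 2 / 4 := by
    have a1 : z * d ≤ z ^ 2 / 2 + L ^ 2 * w ^ 2 / 2 := by nlinarith [sq_nonneg (z - d)]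
    have a2 : -(ε ^ 2 * z * r) ≤ z ^ 2 / 2 + ε ^ 4 * r ^ 2 / 2 := by
      nlinarith [sq_nonneg (z + ε ^ 2 * r)]
    have a3 : -(b * p * r) ≤ r ^ 2 / 4 + L ^ 2 * p ^ 2 := by
      nlinarith [sq_nonneg (b * p + r / 2), mul_le_mul_of_nonneg_right hb2 (sq_nonneg p)]
    have a4 := mul_le_mul_of_nonneg_left a3 (by positivity : 0 ≤ ε ^ 4)
    linarith
  have s3 := cutoff_transport_nonpos (w := w) (z := z) hlam hε hψt
    (by positivity : 0 ≤ ε ^ 4 * lam ^ 2 * p ^ 2 / 2)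
  have s4 : -(2 * ψ * ψx * (lam ^ 2 * p * r)) ≤ ψ ^ 2 * r ^ 2 / 4 + 4 * lam ^ 4 * m ^ 2 * p ^ 2 := by
    have hm : ψx ^ 2 ≤ m ^ 2 := by
      calc ψx ^ 2 = |ψx| ^ 2 := (sq_abs ψx).symm
        _ ≤ m ^ 2 := by gcongr
    have := mul_le_mul_of_nonneg_left hm (by positivity : 0 ≤ 4 * lam ^ 4 * p ^ 2)
    linarith [sq_nonneg (ψ * r / 2 + 2 * lam ^ 2 * ψx * p)]
  have s5 : ψ ^ 2 * (L ^ 2 * w ^ 2 / 2 + ε ^ 4 * L ^ 2 * p ^ 2) ≤ 2 * L ^ 2 / lam ^ 2 *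
      (ψ ^ 2 * (lam ^ 2 * w ^ 2 / 2 + ε ^ 2 * z ^ 2 / 2 + ε ^ 4 * lam ^ 2 * p ^ 2 / 2)) := by
    have : 2 * L ^ 2 / lam ^ 2 *
        (ψ ^ 2 * (lam ^ 2 * w ^ 2 / 2 + ε ^ 2 * z ^ 2 / 2 + ε ^ 4 * lam ^ 2 * p ^ 2 / 2))
        = ψ ^ 2 * (L ^ 2 * w ^ 2 / 2 + ε ^ 4 * L ^ 2 * p ^ 2)
          + (ψ ^ 2 * (L ^ 2 * w ^ 2 / 2) + L ^ 2 / lam ^ 2 * ψ ^ 2 * ε ^ 2 * z ^ 2) := by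
      field_simp
      ring
    rw [this]
    have : 0 ≤ ψ ^ 2 * (L ^ 2 * w ^ 2 / 2) + L ^ 2 / lam ^ 2 * ψ ^ 2 * ε ^ 2 * z ^ 2 := by
      positivity
    linarith
  have s6 := mul_le_mul_of_nonneg_left (s1.le.trans s2) (sq_nonneg ψ)
  have s7 := mul_nonpos_of_nonneg_of_nonpos (by positivity : 0 ≤ 2 * ψ) s3
  have s8 := mul_le_mul_of_nonneg_left s4 (by positivity : 0 ≤ ε ^ 4)
  linarith

variable {T lam ε L B N κ : ℝ} {w z p r d b : ℝ × ℝ → ℝ}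

/-- The relative energy density. -/
noncomputable def energyDensity (lam ε : ℝ) (w z p : ℝ × ℝ → ℝ) (y : ℝ × ℝ) : ℝ :=
  lam ^ 2 * w y ^ 2 / 2 + ε ^ 2 * z y ^ 2 / 2 + ε ^ 4 * lam ^ 2 * p y ^ 2 / 2

/-- Growth of the localized relative energy. -/
theorem integral_cutoff_energy_le (hlam : 0 < lam) (hε : 0 < ε) (hN : 0 < N) (hB : 0 ≤ B)
    (hκ : ∀ y, |deriv Real.smoothTransition y| ≤ κ)
    (hw : ContDiffOn ℝ 1 w (openStrip T)) (hz : ContDiffOn ℝ 1 z (openStrip T))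
    (hp : ContDiffOn ℝ 1 p (openStrip T)) (hr : ContDiffOn ℝ 1 r (openStrip T))
    (h1 : ∀ y ∈ openStrip T, dt w y = -dx z y)
    (h2 : ∀ y ∈ openStrip T, ε ^ 2 * dt z y = -lam ^ 2 * dx w y - z y + d y - ε ^ 2 * r y)
    (h3 : ∀ y ∈ openStrip T, dt p y = dx r y)
    (h4 : ∀ y ∈ openStrip T, lam ^ 2 * dx p y = r y + b y * p y)
    (hd : ∀ y ∈ openStrip T, |d y| ≤ L * |w y|) (hb : ∀ y ∈ openStrip T, |b y| ≤ L)
    (hpB : ∀ t ∈ Ioo 0 T, ∫ x in -(2 * N)..2 * N, p (t, x) ^ 2 ≤ B)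
    {t₀ t₁ : ℝ} (ht0 : 0 < t₀) (h01 : t₀ ≤ t₁) (ht1 : t₁ < T) :
    ∫ x in -(2 * N)..2 * N,
        coneCutoff (lam / ε) N (t₁, x) ^ 2 * energyDensity lam ε w z p (t₁, x)
      ≤ Real.exp (2 * L ^ 2 / lam ^ 2 * (t₁ - t₀)) *
        ((∫ x in -(2 * N)..2 * N,
            coneCutoff (lam / ε) N (t₀, x) ^ 2 * energyDensity lam ε w z p (t₀, x))
          + 4 * ε ^ 4 * lam ^ 4 * (κ / N) ^ 2 * B * (t₁ - t₀)) := by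
  have hc : 0 ≤ lam / ε := by positivity
  have hψ : ContDiffOn ℝ 1 (coneCutoff (lam / ε) N) (openStrip T) :=
    contDiff_coneCutoff.contDiffOn
  set F : ℝ × ℝ → ℝ := fun y => coneCutoff (lam / ε) N y ^ 2 * energyDensity lam ε w z p y with hF
  set G : ℝ × ℝ → ℝ := fun y => coneCutoff (lam / ε) N y ^ 2 *
    (lam ^ 2 * (w y * z y) - ε ^ 4 * lam ^ 2 * (p y * r y)) with hG
  have hFc : ContDiffOn ℝ 1 F (openStrip T) := by
    refine (hψ.pow 2).mul ((ContDiffOn.add ?_ ?_).add ?_)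
    · exact (contDiffOn_const.mul (hw.pow 2)).div_const 2
    · exact (contDiffOn_const.mul (hz.pow 2)).div_const 2
    · exact (contDiffOn_const.mul (hp.pow 2)).div_const 2
  have hGc : ContDiffOn ℝ 1 G (openStrip T) :=
    (hψ.pow 2).mul ((contDiffOn_const.mul (hw.mul hz)).sub (contDiffOn_const.mul (hp.mul hr)))
  have hG0 : ∀ t ∈ Ioo 0 T, ∀ x, |x| = 2 * N → G (t, x) = 0 := by
    intro t ht x hx
    simp [hG, coneCutoff_eq_zero hc hN ht.1.le hx.ge]
  have hN2 : |2 * N| = 2 * N := abs_of_pos (by positivity)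
  refine le_exp_mul_of_hasDerivAt_le (T := T) (y := fun τ => ∫ x in -(2 * N)..2 * N, F (τ, x))
    (by positivity) (by positivity)
    (fun t ht => hasDerivAt_integral_balance hFc hGc ht (hG0 t ht _ (by rw [abs_neg, hN2]))
      (hG0 t ht _ hN2)) (fun t ht => ?_) ht0 h01 ht1
  have hpt : ∀ x, dt F (t, x) + dx G (t, x) ≤ 2 * L ^ 2 / lam ^ 2 * F (t, x)
      + 4 * ε ^ 4 * lam ^ 4 * (κ / N) ^ 2 * p (t, x) ^ 2 := by
    intro x
    have hy := mk_mem_openStrip ht x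
    obtain ⟨ψt, ψx, e1, e2, e3, e4⟩ := exists_hasDerivAt_coneCutoff hκ hc hN t x
    have eF := (e1.fun_pow 2).fun_mul
      ((((((hasDerivAt_dt hw ht x).fun_pow 2).const_mul (lam ^ 2)).div_const 2).fun_add
      ((((hasDerivAt_dt hz ht x).fun_pow 2).const_mul (ε ^ 2)).div_const 2)).fun_add
      ((((hasDerivAt_dt hp ht x).fun_pow 2).const_mul (ε ^ 4 * lam ^ 2)).div_const 2))
    have eG := (e2.fun_pow 2).fun_mul
      ((((hasDerivAt_dx hw ht x).fun_mul (hasDerivAt_dx hz ht x)).const_mul (lam ^ 2)).fun_sub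
      (((hasDerivAt_dx hp ht x).fun_mul (hasDerivAt_dx hr ht x)).const_mul (ε ^ 4 * lam ^ 2)))
    rw [(hasDerivAt_dt hFc ht x).unique eF, (hasDerivAt_dx hGc ht x).unique eG]
    have key := cutoff_energy_dissipation hlam hε
      (coneCutoff_nonneg (c := lam / ε) (N := N) (t, x)) e3 e4 (h1 _ hy)
      (h2 _ hy) (h3 _ hy) (h4 _ hy) (hd _ hy) (hb _ hy)
    simp only [hF, energyDensity]
    refine le_trans (le_of_eq ?_) key
    push_cast
    ring
  have i1 : Continuous fun x => dt F (t, x) := continuous_slice (continuousOn_dt hFc) ht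
  have i2 : Continuous fun x => dx G (t, x) := continuous_slice (continuousOn_dx hGc) ht
  have i3 : Continuous fun x => F (t, x) := continuous_slice hFc.continuousOn ht
  have i4 : Continuous fun x => p (t, x) := continuous_slice hp.continuousOn ht
  calc ∫ x in -(2 * N)..2 * N, (dt F (t, x) + dx G (t, x))
      ≤ ∫ x in -(2 * N)..2 * N, (2 * L ^ 2 / lam ^ 2 * F (t, x)
        + 4 * ε ^ 4 * lam ^ 4 * (κ / N) ^ 2 * p (t, x) ^ 2) := by
        refine intervalIntegral.integral_mono_on (by linarith) ?_ ?_ fun x _ => hpt x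
        · exact (i1.add i2).intervalIntegrable _ _
        · exact ((continuous_const.mul i3).add
            (continuous_const.mul (i4.pow 2))).intervalIntegrable _ _
    _ = 2 * L ^ 2 / lam ^ 2 * (∫ x in -(2 * N)..2 * N, F (t, x))
        + 4 * ε ^ 4 * lam ^ 4 * (κ / N) ^ 2 * ∫ x in -(2 * N)..2 * N, p (t, x) ^ 2 := by
        rw [intervalIntegral.integral_add ((i3.const_mul _).intervalIntegrable _ _)
          (((i4.fun_pow 2).const_mul _).intervalIntegrable _ _),
          intervalIntegral.integral_const_mul, intervalIntegral.integral_const_mul]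
    _ ≤ _ := by
        have := mul_le_mul_of_nonneg_left (hpB t ht)
          (by positivity : 0 ≤ 4 * ε ^ 4 * lam ^ 4 * (κ / N) ^ 2)
        linarith

end Energy

/-! ### Convergence of the localized energy -/

section Localization

theorem continuousOn_intervalIntegral_slice {T : ℝ} (hT : 0 ≤ T) {g : ℝ × ℝ → ℝ}
    (hg : ContinuousOn g (Icc 0 T ×ˢ univ)) (a b : ℝ) :
    ContinuousOn (fun t => ∫ x in a..b, g (t, x)) (Icc 0 T) := by
  have h1 : Continuous (Function.uncurry fun t x : ℝ => g ((projIcc 0 T hT t : ℝ), x)) :=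
    hg.comp_continuous (f := fun p : ℝ × ℝ => ((projIcc 0 T hT p.1 : ℝ), p.2))
      ((continuous_subtype_val.comp (continuous_projIcc.comp continuous_fst)).prodMk
        continuous_snd) fun p => ⟨(projIcc 0 T hT p.1).2, mem_univ _⟩
  refine ((intervalIntegral.continuous_parametric_intervalIntegral_of_continuous'
    (μ := volume) h1 a b).continuousOn (s := Icc 0 T)).congr fun t ht => ?_
  simp only [projIcc_of_mem hT ht]

variable {T lam ε L B C₀ : ℝ} {w z p r d b : ℝ × ℝ → ℝ}

/-- The relative energy estimate: if `w` and `z` vanish initially and `p` is initially bounded by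
`√C₀` in `L²`, then `w` is of order `ε²` in `L²`. -/
theorem integral_sq_le_of_relative_energy (hT : 0 < T) (hlam : 0 < lam) (hε : 0 < ε) (hB : 0 ≤ B)
    (hw : ContDiffOn ℝ 1 w (openStrip T)) (hz : ContDiffOn ℝ 1 z (openStrip T))
    (hp : ContDiffOn ℝ 1 p (openStrip T)) (hr : ContDiffOn ℝ 1 r (openStrip T))
    (h1 : ∀ y ∈ openStrip T, dt w y = -dx z y)
    (h2 : ∀ y ∈ openStrip T, ε ^ 2 * dt z y = -lam ^ 2 * dx w y - z y + d y - ε ^ 2 * r y)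
    (h3 : ∀ y ∈ openStrip T, dt p y = dx r y)
    (h4 : ∀ y ∈ openStrip T, lam ^ 2 * dx p y = r y + b y * p y)
    (hd : ∀ y ∈ openStrip T, |d y| ≤ L * |w y|) (hb : ∀ y ∈ openStrip T, |b y| ≤ L)
    (hpB : ∀ t ∈ Ioo 0 T, ∀ R, 0 < R → ∫ x in -R..R, p (t, x) ^ 2 ≤ B)
    (hw0 : ContinuousOn w (Icc 0 T ×ˢ univ)) (hz0 : ContinuousOn z (Icc 0 T ×ˢ univ))
    (hwi : ∀ x, w (0, x) = 0) (hzi : ∀ x, z (0, x) = 0)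
    (hpC : ∀ᶠ t in 𝓝[>] 0, ∀ R, 0 < R → ∫ x in -R..R, p (t, x) ^ 2 ≤ C₀)
    {t : ℝ} (ht : t ∈ Icc 0 T) {R : ℝ} (hR : 0 < R) :
    ∫ x in -R..R, w (t, x) ^ 2 ≤ ε ^ 4 * C₀ * Real.exp (2 * L ^ 2 / lam ^ 2 * t) := by
  obtain ⟨κ, hκ0, hκ⟩ := exists_abs_deriv_smoothTransition_le
  have hcl : ContinuousOn (fun t => ∫ x in -R..R, w (t, x) ^ 2) (Icc 0 T) :=
    continuousOn_intervalIntegral_slice hT.le (hw0.pow 2) _ _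
  rw [← closure_Ioo hT.ne] at hcl ht
  refine le_on_closure (g := fun t => ε ^ 4 * C₀ * Real.exp (2 * L ^ 2 / lam ^ 2 * t))
    (fun t ht => ?_) hcl (by fun_prop) ht
  clear hcl
  set k := 2 * L ^ 2 / lam ^ 2 with hk
  have hk0 : 0 ≤ k := by positivity
  have hpc : ∀ s ∈ Ioo 0 T, Continuous fun x => p (s, x) := fun s hs =>
    continuous_slice hp.continuousOn hs
  have hwc : ∀ s ∈ Ioo 0 T, Continuous fun x => w (s, x) := fun s hs =>
    continuous_slice hw.continuousOn hs
  have hzc : ∀ s ∈ Ioo 0 T, Continuous fun x => z (s, x) := fun s hs =>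
    continuous_slice hz.continuousOn hs
  have hψc : ∀ N s, Continuous fun x => coneCutoff (lam / ε) N (s, x) := fun N s =>
    (contDiff_coneCutoff (c := lam / ε) (N := N)).continuous.comp (by fun_prop)
  have hec : ∀ s ∈ Ioo 0 T, Continuous fun x => energyDensity lam ε w z p (s, x) := by
    intro s hs
    unfold energyDensity
    exact (((((hwc s hs).pow 2).const_mul _).div_const 2).add
      ((((hzc s hs).pow 2).const_mul _).div_const 2)).add
      ((((hpc s hs).pow 2).const_mul _).div_const 2)
  -- the estimate at a fixed scale and a fixed initial time
  have main : ∀ N, 1 + R + lam / ε * T ≤ N → ∀ t₀ ∈ Ioo 0 t,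
      (∀ R, 0 < R → ∫ x in -R..R, p (t₀, x) ^ 2 ≤ C₀) →
      lam ^ 2 / 2 * ∫ x in -R..R, w (t, x) ^ 2 ≤ Real.exp (k * t) *
        ((∫ x in -(2 * N)..2 * N,
            (lam ^ 2 * w (t₀, x) ^ 2 / 2 + ε ^ 2 * z (t₀, x) ^ 2 / 2))
          + ε ^ 4 * lam ^ 2 / 2 * C₀ + 4 * ε ^ 4 * lam ^ 4 * (κ / N) ^ 2 * B * t) := by
    intro N hN t₀ ht₀ hC
    have hcT : 0 ≤ lam / ε * T := by positivity
    have hN0 : 0 < N := by linarith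
    have ht₀T : t₀ ∈ Ioo 0 T := ⟨ht₀.1, ht₀.2.trans ht.2⟩
    have e1 := integral_cutoff_energy_le hlam hε hN0 hB hκ hw hz hp hr h1 h2 h3 h4 hd hb
      (fun s hs => hpB s hs (2 * N) (by positivity)) ht₀.1 ht₀.2.le ht.2
    have i1 : Continuous fun x =>
        coneCutoff (lam / ε) N (t, x) ^ 2 * energyDensity lam ε w z p (t, x) :=
      ((hψc N t).pow 2).mul (hec t ht)
    have e2 : lam ^ 2 / 2 * ∫ x in -R..R, w (t, x) ^ 2 ≤ ∫ x in -(2 * N)..2 * N,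
        coneCutoff (lam / ε) N (t, x) ^ 2 * energyDensity lam ε w z p (t, x) := by
      rw [← intervalIntegral.integral_const_mul]
      calc ∫ x in -R..R, lam ^ 2 / 2 * w (t, x) ^ 2
          ≤ ∫ x in -R..R,
              coneCutoff (lam / ε) N (t, x) ^ 2 * energyDensity lam ε w z p (t, x) := by
            refine intervalIntegral.integral_mono_on (by linarith)
              ((((hwc t ht).fun_pow 2).const_mul _).intervalIntegrable _ _)
              (i1.intervalIntegrable _ _) fun x hx => ?_
            have hx' : |x| ≤ R := abs_le.2 hx
            have hct : lam / ε * t ≤ lam / ε * T := by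
              have := ht.2.le
              gcongr
            rw [coneCutoff_eq_one hN0 (by linarith), energyDensity]
            have : 0 ≤ ε ^ 2 * z (t, x) ^ 2 / 2 := by positivity
            have : 0 ≤ ε ^ 4 * lam ^ 2 * p (t, x) ^ 2 / 2 := by positivity
            linarith
        _ ≤ _ := by
            refine intervalIntegral.integral_mono_interval (by linarith) (by linarith)
              (by linarith) (Eventually.of_forall fun x => ?_) (i1.intervalIntegrable _ _)
            have : 0 ≤ energyDensity lam ε w z p (t, x) := by
              unfold energyDensity; positivity
            exact mul_nonneg (sq_nonneg _) this
    have i2 : Continuous fun x => lam ^ 2 * w (t₀, x) ^ 2 / 2 + ε ^ 2 * z (t₀, x) ^ 2 / 2 :=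
      ((((hwc t₀ ht₀T).pow 2).const_mul _).div_const 2).add
        ((((hzc t₀ ht₀T).pow 2).const_mul _).div_const 2)
    have i3 : Continuous fun x => ε ^ 4 * lam ^ 2 / 2 * p (t₀, x) ^ 2 :=
      ((hpc t₀ ht₀T).fun_pow 2).const_mul _
    have e3 : (∫ x in -(2 * N)..2 * N,
          coneCutoff (lam / ε) N (t₀, x) ^ 2 * energyDensity lam ε w z p (t₀, x))
        ≤ (∫ x in -(2 * N)..2 * N,
            (lam ^ 2 * w (t₀, x) ^ 2 / 2 + ε ^ 2 * z (t₀, x) ^ 2 / 2))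
          + ε ^ 4 * lam ^ 2 / 2 * C₀ := by
      have e4 : ε ^ 4 * lam ^ 2 / 2 * ∫ x in -(2 * N)..2 * N, p (t₀, x) ^ 2
          ≤ ε ^ 4 * lam ^ 2 / 2 * C₀ := by
        have := hC (2 * N) (by positivity)
        gcongr
      refine le_trans ?_ (add_le_add le_rfl e4)
      rw [← intervalIntegral.integral_const_mul, ← intervalIntegral.integral_add
        (i2.intervalIntegrable _ _) (i3.intervalIntegrable _ _)]
      refine intervalIntegral.integral_mono_on (by linarith)
        ((((hψc N t₀).pow 2).mul (hec t₀ ht₀T)).intervalIntegrable _ _)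
        ((i2.add i3).intervalIntegrable _ _) fun x _ => ?_
      have h5 : coneCutoff (lam / ε) N (t₀, x) ^ 2 ≤ 1 :=
        pow_le_one₀ (coneCutoff_nonneg _) (coneCutoff_le_one _)
      have h6 : 0 ≤ energyDensity lam ε w z p (t₀, x) := by
        unfold energyDensity; positivity
      calc coneCutoff (lam / ε) N (t₀, x) ^ 2 * energyDensity lam ε w z p (t₀, x)
          ≤ energyDensity lam ε w z p (t₀, x) := mul_le_of_le_one_left h6 h5
        _ = _ := by rw [energyDensity]; ring
    have e5 : Real.exp (k * (t - t₀)) ≤ Real.exp (k * t) := by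
      have : t - t₀ ≤ t := by linarith [ht₀.1]
      gcongr
    refine e2.trans (e1.trans ?_)
    have h7 : 0 ≤ ∫ x in -(2 * N)..2 * N,
        coneCutoff (lam / ε) N (t₀, x) ^ 2 * energyDensity lam ε w z p (t₀, x) := by
      refine intervalIntegral.integral_nonneg (by linarith) fun x _ => ?_
      have : 0 ≤ energyDensity lam ε w z p (t₀, x) := by
        unfold energyDensity; positivity
      positivity
    have h8 : 4 * ε ^ 4 * lam ^ 4 * (κ / N) ^ 2 * B * (t - t₀)
        ≤ 4 * ε ^ 4 * lam ^ 4 * (κ / N) ^ 2 * B * t := by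
      have : t - t₀ ≤ t := by linarith [ht₀.1]
      gcongr
    have h9 : 0 ≤ 4 * ε ^ 4 * lam ^ 4 * (κ / N) ^ 2 * B * (t - t₀) :=
      mul_nonneg (by positivity) (by linarith [ht₀.2])
    exact mul_le_mul e5 (add_le_add e3 h8) (add_nonneg h7 h9) (Real.exp_pos _).le
  -- the initial time tends to zero
  have step1 : ∀ N, 1 + R + lam / ε * T ≤ N →
      lam ^ 2 / 2 * ∫ x in -R..R, w (t, x) ^ 2 ≤ Real.exp (k * t) *
        (0 + ε ^ 4 * lam ^ 2 / 2 * C₀ + 4 * ε ^ 4 * lam ^ 4 * (κ / N) ^ 2 * B * t) := by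
    intro N hN
    have hlim : Tendsto (fun s => ∫ x in -(2 * N)..2 * N,
        (lam ^ 2 * w (s, x) ^ 2 / 2 + ε ^ 2 * z (s, x) ^ 2 / 2)) (𝓝[>] 0) (𝓝 0) := by
      have hcont : ContinuousOn (fun y : ℝ × ℝ => lam ^ 2 * w y ^ 2 / 2 + ε ^ 2 * z y ^ 2 / 2)
          (Icc 0 T ×ˢ univ) := by fun_prop
      have := (continuousOn_intervalIntegral_slice hT.le hcont (-(2 * N)) (2 * N)) 0
        (left_mem_Icc.2 hT.le)
      have h0 : (∫ x in -(2 * N)..2 * N,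
          (lam ^ 2 * w (0, x) ^ 2 / 2 + ε ^ 2 * z (0, x) ^ 2 / 2)) = 0 := by
        simp [hwi, hzi]
      rw [ContinuousWithinAt, h0] at this
      refine this.mono_left ?_
      rw [← nhdsWithin_Ioc_eq_nhdsGT hT]
      exact nhdsWithin_mono _ Ioc_subset_Icc_self
    refine ge_of_tendsto (((hlim.add_const _).add_const _).const_mul _) ?_
    filter_upwards [hpC, Ioo_mem_nhdsGT ht.1] with t₀ hC ht₀
    exact main N hN t₀ ht₀ hC
  -- the scale tends to infinity
  have hlim2 : Tendsto (fun N : ℝ => Real.exp (k * t) *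
        (0 + ε ^ 4 * lam ^ 2 / 2 * C₀ + 4 * ε ^ 4 * lam ^ 4 * (κ / N) ^ 2 * B * t)) atTop
      (𝓝 (Real.exp (k * t) *
        (0 + ε ^ 4 * lam ^ 2 / 2 * C₀ + 4 * ε ^ 4 * lam ^ 4 * 0 ^ 2 * B * t))) := by
    have h0 : Tendsto (fun N : ℝ => κ / N) atTop (𝓝 0) := tendsto_const_nhds.div_atTop tendsto_id
    exact (((((h0.pow 2).const_mul _).mul_const _).mul_const _).const_add _).const_mul _
  have step2 := ge_of_tendsto hlim2 ((eventually_ge_atTop (1 + R + lam / ε * T)).mono step1)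
  have hl2 : 0 < lam ^ 2 / 2 := by positivity
  refine le_of_mul_le_mul_left (step2.trans (le_of_eq ?_)) hl2
  ring

/-- A bound for the `L²` norm from bounds on bounded intervals. -/
theorem eLpNorm_two_le_of_intervalIntegral_le {g : ℝ → ℝ} (hg : Continuous g) {D : ℝ} (hD : 0 ≤ D)
    (h : ∀ R, 0 < R → ∫ x in -R..R, g x ^ 2 ≤ D ^ 2) :
    eLpNorm g 2 volume ≤ ENNReal.ofReal D := by
  have hi : Integrable fun x => g x ^ 2 := by
    refine integrable_of_intervalIntegral_norm_bounded (l := atTop) (a := fun R : ℝ => -R)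
      (b := fun R => R) (D ^ 2) (fun R => ((hg.pow 2).continuousOn.integrableOn_Icc).mono_set
        Ioc_subset_Icc_self) tendsto_neg_atTop_atBot tendsto_id ?_
    filter_upwards [eventually_gt_atTop 0] with R hR
    simpa using h R hR
  have hle : ∫ x, g x ^ 2 ≤ D ^ 2 := by
    refine le_of_tendsto (intervalIntegral_tendsto_integral (l := atTop) (a := fun R : ℝ => -R)
      (b := fun R => R) hi tendsto_neg_atTop_atBot tendsto_id) ?_
    filter_upwards [eventually_gt_atTop 0] with R hR
    exact h R hR
  have hm : MemLp g 2 volume := (memLp_two_iff_integrable_sq hg.aestronglyMeasurable).2 hi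
  rw [hm.eLpNorm_eq_integral_rpow_norm two_ne_zero ENNReal.ofNat_ne_top]
  refine ENNReal.ofReal_le_ofReal ?_
  have : (∫ x, ‖g x‖ ^ (2 : ℝ≥0∞).toReal) = ∫ x, g x ^ 2 := by
    refine integral_congr_ae (Eventually.of_forall fun x => ?_)
    simp
  rw [this]
  simp only [ENNReal.toReal_ofNat]
  rw [← one_div, ← Real.sqrt_eq_rpow]
  exact (Real.sqrt_le_sqrt hle).trans (Real.sqrt_sq hD).le

end Localization

/-! ### The flux -/

section Flux

variable {f : ℝ → ℝ} {a : ℝ}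

theorem FluxAssumption.contDiff (hf : FluxAssumption f a) : ContDiff ℝ ∞ f := by
  obtain ⟨h, _, hh⟩ := hf.exists_poly
  rw [funext hh]
  exact (contDiff_const.mul contDiff_id).add (by simpa using h.contDiff_aeval (𝕜 := ℝ) ∞)

theorem exists_deriv_bound (hf : ContDiff ℝ ∞ f) :
    ∃ L : ℝ → ℝ, ∀ ρ y, |y| ≤ ρ → |deriv f y| ≤ L ρ := by
  have : ∀ ρ : ℝ, ∃ C, ∀ y, |y| ≤ ρ → |deriv f y| ≤ C := by
    intro ρ
    obtain ⟨C, hC⟩ := isCompact_Icc.exists_bound_of_continuousOn (s := Icc (-ρ) ρ)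
      (hf.continuous_deriv (by simp)).continuousOn
    exact ⟨C, fun y hy => hC y (abs_le.1 hy)⟩
  choose L hL using this
  exact ⟨L, hL⟩

theorem abs_sub_le_of_deriv_bound (hf : ContDiff ℝ ∞ f) {L ρ : ℝ}
    (hL : ∀ y, |y| ≤ ρ → |deriv f y| ≤ L) {u v : ℝ} (hu : |u| ≤ ρ) (hv : |v| ≤ ρ) :
    |f u - f v| ≤ L * |u - v| :=
  (convex_Icc (-ρ) ρ).norm_image_sub_le_of_norm_deriv_le
    (fun y _ => hf.differentiable (by simp) y) (fun y hy => hL y (abs_le.2 hy))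
    (abs_le.1 hv) (abs_le.1 hu)

end Flux

/-! ### The limit equation -/

section LimitEquation

open scoped Real

variable {lam s T : ℝ} {f u₀ : ℝ → ℝ} {ubar : ℝ → ℝ → ℝ}

/-- The flux `f(ū) - λ² ∂ₓ ū` of the limit equation. -/
noncomputable def viscousFlux (lam : ℝ) (f : ℝ → ℝ) (ubar : ℝ → ℝ → ℝ) (y : ℝ × ℝ) : ℝ :=
  f (ubar y.1 y.2) - lam ^ 2 * deriv (ubar y.1) y.2

theorem IsSmoothSolution.dx_eq (h : IsSmoothSolution lam f s T u₀ ubar) {t : ℝ}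
    (ht : t ∈ Ioo 0 T) (x : ℝ) : dx (Function.uncurry ubar) (t, x) = deriv (ubar t) x :=
  (hasDerivAt_dx (h.smooth.of_le (by simp)) ht x).deriv.symm

theorem IsSmoothSolution.contDiffOn_comp (hf : ContDiff ℝ ∞ f)
    (h : IsSmoothSolution lam f s T u₀ ubar) :
    ContDiffOn ℝ ∞ (fun y => f (Function.uncurry ubar y)) (openStrip T) :=
  hf.comp_contDiffOn h.smooth

theorem IsSmoothSolution.viscousFlux_eqOn (h : IsSmoothSolution lam f s T u₀ ubar) :
    EqOn (viscousFlux lam f ubar) (fun y => f (Function.uncurry ubar y)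
      - lam ^ 2 * dx (Function.uncurry ubar) y) (openStrip T) := by
  rintro ⟨t, x⟩ ⟨ht, _⟩
  simp only [viscousFlux, h.dx_eq ht, Function.uncurry]

theorem IsSmoothSolution.contDiffOn_viscousFlux (hf : ContDiff ℝ ∞ f)
    (h : IsSmoothSolution lam f s T u₀ ubar) :
    ContDiffOn ℝ ∞ (viscousFlux lam f ubar) (openStrip T) :=
  ((h.contDiffOn_comp hf).sub (contDiffOn_const.mul (contDiffOn_dx h.smooth))).congr
    h.viscousFlux_eqOn

theorem IsSmoothSolution.continuousOn_viscousFlux (hf : ContDiff ℝ ∞ f)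
    (h : IsSmoothSolution lam f s T u₀ ubar) :
    ContinuousOn (viscousFlux lam f ubar) (Icc 0 T ×ˢ univ) :=
  (hf.continuous.comp_continuousOn h.cont).sub (continuousOn_const.mul h.cont_deriv)

theorem IsSmoothSolution.hasDerivAt_deriv (h : IsSmoothSolution lam f s T u₀ ubar) {t : ℝ}
    (ht : t ∈ Icc 0 T) (x : ℝ) :
    HasDerivAt (deriv (ubar t)) (deriv (deriv (ubar t)) x) x := by
  have h2 : ContDiff ℝ (1 + 1) (ubar t) := by
    simpa [one_add_one_eq_two] using h.contDiff_slice t ht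
  exact (((contDiff_succ_iff_deriv).1 h2).2.2.differentiable one_ne_zero x).hasDerivAt

theorem IsSmoothSolution.hasDerivAt_comp (hf : ContDiff ℝ ∞ f)
    (h : IsSmoothSolution lam f s T u₀ ubar) {t : ℝ} (ht : t ∈ Icc 0 T) (x : ℝ) :
    HasDerivAt (fun y => f (ubar t y)) (deriv f (ubar t x) * deriv (ubar t) x) x :=
  (hf.differentiable (by simp) _).hasDerivAt.comp x
    (((h.contDiff_slice t ht).differentiable two_ne_zero x).hasDerivAt)

theorem IsSmoothSolution.dt_eq (hf : ContDiff ℝ ∞ f) (h : IsSmoothSolution lam f s T u₀ ubar)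
    {t : ℝ} (ht : t ∈ Ioo 0 T) (x : ℝ) :
    dt (Function.uncurry ubar) (t, x)
      = lam ^ 2 * deriv (deriv (ubar t)) x - deriv f (ubar t x) * deriv (ubar t) x := by
  have h1 := h.eqn t ht x
  have h2 : deriv (fun τ => ubar τ x) t = dt (Function.uncurry ubar) (t, x) :=
    (hasDerivAt_dt (h.smooth.of_le (by simp)) ht x).deriv
  rw [h2, (h.hasDerivAt_comp hf (Ioo_subset_Icc_self ht) x).deriv, iteratedDeriv_succ,
    iteratedDeriv_one] at h1
  linarith

/-- The conservation law `∂ₜ ū = - ∂ₓ (f(ū) - λ² ∂ₓ ū)`. -/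
theorem IsSmoothSolution.dx_viscousFlux (hf : ContDiff ℝ ∞ f)
    (h : IsSmoothSolution lam f s T u₀ ubar) {y : ℝ × ℝ} (hy : y ∈ openStrip T) :
    dx (viscousFlux lam f ubar) y = -dt (Function.uncurry ubar) y := by
  obtain ⟨t, x⟩ := y
  have ht : t ∈ Ioo 0 T := hy.1
  have e1 := hasDerivAt_dx ((h.contDiffOn_viscousFlux hf).of_le (by simp)) ht x
  have e2 := (h.hasDerivAt_comp hf (Ioo_subset_Icc_self ht) x).fun_sub
    ((h.hasDerivAt_deriv (Ioo_subset_Icc_self ht) x).const_mul (lam ^ 2))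
  rw [e1.unique e2, h.dt_eq hf ht]
  ring

/-- The flux of the limit equation satisfies a linear parabolic equation. -/
theorem IsSmoothSolution.dt_viscousFlux (hf : ContDiff ℝ ∞ f)
    (h : IsSmoothSolution lam f s T u₀ ubar) {y : ℝ × ℝ} (hy : y ∈ openStrip T) :
    dt (viscousFlux lam f ubar) y
      = deriv f (Function.uncurry ubar y) * dt (Function.uncurry ubar) y
        - lam ^ 2 * dx (dt (Function.uncurry ubar)) y := by
  rw [dt_congr h.viscousFlux_eqOn hy, ← dt_dx_comm h.smooth hy]
  obtain ⟨t, x⟩ := y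
  have ht : t ∈ Ioo 0 T := hy.1
  have e0 := hasDerivAt_dt (h.smooth.of_le (by simp)) ht x
  have e1 : HasDerivAt (fun τ => f (Function.uncurry ubar (τ, x)))
      (deriv f (Function.uncurry ubar (t, x)) * dt (Function.uncurry ubar) (t, x)) t :=
    (hf.differentiable (by simp) _).hasDerivAt.comp t e0
  have e2 := hasDerivAt_dt ((contDiffOn_dx h.smooth).of_le (by simp)) ht x
  have e3 := hasDerivAt_dt (((h.contDiffOn_comp hf).sub
    ((contDiffOn_const (c := lam ^ 2)).mul (contDiffOn_dx h.smooth))).of_le (by simp)) ht x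
  exact e3.unique (e1.fun_sub (e2.const_mul (lam ^ 2)))

theorem IsSmoothSolution.dt_dt_eq (hf : ContDiff ℝ ∞ f)
    (h : IsSmoothSolution lam f s T u₀ ubar) {y : ℝ × ℝ} (hy : y ∈ openStrip T) :
    dt (fun y => -dt (Function.uncurry ubar) y) y = dx (dt (viscousFlux lam f ubar)) y := by
  rw [← dt_dx_comm (h.contDiffOn_viscousFlux hf) hy]
  exact (dt_congr (fun y hy => h.dx_viscousFlux hf hy) hy).symm

/-- A function of Bessel order at least two is bounded. -/
theorem abs_le_of_hasBesselPotential {σ : ℝ} (hσ : 2 ≤ σ) {g : ℝ → ℝ} (hg : ContDiff ℝ 2 g)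
    {G : Lp ℂ 2 (volume : Measure ℝ)} (h : HasBesselPotential σ g G) {A : ℝ} (hA : ‖G‖ ≤ A)
    (x : ℝ) : |g x| ≤ √(2 * ((2 * π) ^ 4 * A ^ 2)) := by
  obtain ⟨⟨i0, j0⟩, ⟨i1, j1⟩, _⟩ := integral_sq_le_of_hasBesselPotential hσ hg h
  have h1 := sq_le_integral_sq_add_integral_deriv_sq (hg.of_le (by norm_num)) i0 i1 x
  have h2 : (2 * π) ^ 4 * ‖G‖ ^ 2 ≤ (2 * π) ^ 4 * A ^ 2 := by gcongr
  exact Real.abs_le_sqrt (by linarith)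

/-- The time derivative of the limit solution is bounded in `L²` by its Sobolev norm. -/
theorem IsSmoothSolution.integral_dt_sq_le (hf : ContDiff ℝ ∞ f)
    (h : IsSmoothSolution lam f s T u₀ ubar) {σ : ℝ} (hσ : 2 ≤ σ) {t : ℝ} (ht : t ∈ Ioo 0 T)
    {G : Lp ℂ 2 (volume : Measure ℝ)} (hG : HasBesselPotential σ (ubar t) G) {A : ℝ}
    (hA : ‖G‖ ≤ A) {L : ℝ} (hL : ∀ x, |deriv f (ubar t x)| ≤ L) {R : ℝ} (hR : 0 < R) :
    ∫ x in -R..R, (-dt (Function.uncurry ubar) (t, x)) ^ 2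
      ≤ 2 * (L ^ 2 + lam ^ 4) * ((2 * π) ^ 4 * A ^ 2) := by
  have hc := h.contDiff_slice t (Ioo_subset_Icc_self ht)
  obtain ⟨_, ⟨i1, j1⟩, ⟨i2, j2⟩⟩ := integral_sq_le_of_hasBesselPotential hσ hc hG
  have hcont : Continuous fun x => dt (Function.uncurry ubar) (t, x) :=
    continuous_slice (continuousOn_dt (h.smooth.of_le (by simp))) ht
  have hi : Integrable fun x =>
      2 * L ^ 2 * deriv (ubar t) x ^ 2 + 2 * lam ^ 4 * deriv (deriv (ubar t)) x ^ 2 :=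
    (i1.const_mul _).add (i2.const_mul _)
  have h2 : (2 * π) ^ 4 * ‖G‖ ^ 2 ≤ (2 * π) ^ 4 * A ^ 2 := by gcongr
  calc ∫ x in -R..R, (-dt (Function.uncurry ubar) (t, x)) ^ 2
      ≤ ∫ x in -R..R,
          (2 * L ^ 2 * deriv (ubar t) x ^ 2 + 2 * lam ^ 4 * deriv (deriv (ubar t)) x ^ 2) := by
        refine intervalIntegral.integral_mono_on (by linarith)
          ((hcont.neg.pow 2).intervalIntegrable _ _) hi.intervalIntegrable fun x _ => ?_
        rw [h.dt_eq hf ht]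
        have : deriv f (ubar t x) ^ 2 ≤ L ^ 2 := by
          rw [← sq_abs (deriv f (ubar t x))]
          gcongr
          exact hL x
        have := mul_le_mul_of_nonneg_right this (sq_nonneg (deriv (ubar t) x))
        nlinarith [sq_nonneg (lam ^ 2 * deriv (deriv (ubar t)) x
          + deriv f (ubar t x) * deriv (ubar t) x)]
    _ ≤ ∫ x, (2 * L ^ 2 * deriv (ubar t) x ^ 2 + 2 * lam ^ 4 * deriv (deriv (ubar t)) x ^ 2) := by
        rw [intervalIntegral.integral_of_le (by linarith)]
        exact setIntegral_le_integral hi (Eventually.of_forall fun x => by positivity)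
    _ = 2 * L ^ 2 * (∫ x, deriv (ubar t) x ^ 2)
          + 2 * lam ^ 4 * ∫ x, deriv (deriv (ubar t)) x ^ 2 := by
        rw [integral_add (i1.const_mul _) (i2.const_mul _), integral_const_mul,
          integral_const_mul]
    _ ≤ 2 * L ^ 2 * ((2 * π) ^ 4 * A ^ 2) + 2 * lam ^ 4 * ((2 * π) ^ 4 * A ^ 2) := by
        have := j1.trans h2
        have := j2.trans h2
        gcongr
    _ = _ := by ring

end LimitEquation

/-! ### The BGK model in macroscopic variables -/

section Macroscopic

variable {lam ε T : ℝ} {f : ℝ → ℝ} {f₁ f₂ : ℝ → ℝ → ℝ}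

/-- The scaled momentum `(λ/ε) (f₁ - f₂)`. -/
noncomputable def bgkMomentum (lam ε : ℝ) (f₁ f₂ : ℝ → ℝ → ℝ) (y : ℝ × ℝ) : ℝ :=
  lam / ε * (Function.uncurry f₁ y - Function.uncurry f₂ y)

/-- The density `f₁ + f₂`. -/
def bgkDensity (f₁ f₂ : ℝ → ℝ → ℝ) (y : ℝ × ℝ) : ℝ :=
  Function.uncurry f₁ y + Function.uncurry f₂ y

theorem IsBGKSolution.contDiffOn_density (h : IsBGKSolution lam f ε T f₁ f₂) :
    ContDiffOn ℝ 1 (bgkDensity f₁ f₂) (openStrip T) :=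
  h.contDiff₁.add h.contDiff₂

theorem IsBGKSolution.contDiffOn_momentum (h : IsBGKSolution lam f ε T f₁ f₂) :
    ContDiffOn ℝ 1 (bgkMomentum lam ε f₁ f₂) (openStrip T) :=
  contDiffOn_const.mul (h.contDiff₁.sub h.contDiff₂)

theorem IsBGKSolution.continuousOn_density (h : IsBGKSolution lam f ε T f₁ f₂) :
    ContinuousOn (bgkDensity f₁ f₂) (Icc 0 T ×ˢ univ) :=
  h.cont₁.add h.cont₂

theorem IsBGKSolution.continuousOn_momentum (h : IsBGKSolution lam f ε T f₁ f₂) :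
    ContinuousOn (bgkMomentum lam ε f₁ f₂) (Icc 0 T ×ˢ univ) :=
  continuousOn_const.mul (h.cont₁.sub h.cont₂)

/-- Conservation of mass and relaxation of the momentum. -/
theorem IsBGKSolution.macroscopic (hlam : 0 < lam) (hε : 0 < ε)
    (h : IsBGKSolution lam f ε T f₁ f₂) {y : ℝ × ℝ} (hy : y ∈ openStrip T) :
    dt (bgkDensity f₁ f₂) y = -dx (bgkMomentum lam ε f₁ f₂) y ∧
    ε ^ 2 * dt (bgkMomentum lam ε f₁ f₂) y
      = -lam ^ 2 * dx (bgkDensity f₁ f₂) y + f (bgkDensity f₁ f₂ y)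
        - bgkMomentum lam ε f₁ f₂ y := by
  obtain ⟨t, x⟩ := y
  have ht : t ∈ Ioo 0 T := hy.1
  have t1 := hasDerivAt_dt h.contDiff₁ ht x
  have t2 := hasDerivAt_dt h.contDiff₂ ht x
  have x1 := hasDerivAt_dx h.contDiff₁ ht x
  have x2 := hasDerivAt_dx h.contDiff₂ ht x
  have q1 := h.eqn₁ t ht x
  have q2 := h.eqn₂ t ht x
  have a1 : deriv (fun τ => f₁ τ x) t = dt (Function.uncurry f₁) (t, x) := t1.deriv
  have a2 : deriv (fun τ => f₂ τ x) t = dt (Function.uncurry f₂) (t, x) := t2.deriv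
  have b1 : deriv (f₁ t) x = dx (Function.uncurry f₁) (t, x) := x1.deriv
  have b2 : deriv (f₂ t) x = dx (Function.uncurry f₂) (t, x) := x2.deriv
  rw [a1, b1] at q1
  rw [a2, b2] at q2
  rw [(hasDerivAt_dt h.contDiffOn_density ht x).unique (t1.fun_add t2),
    (hasDerivAt_dx h.contDiffOn_density ht x).unique (x1.fun_add x2),
    (hasDerivAt_dt h.contDiffOn_momentum ht x).unique ((t1.fun_sub t2).const_mul (lam / ε)),
    (hasDerivAt_dx h.contDiffOn_momentum ht x).unique ((x1.fun_sub x2).const_mul (lam / ε))]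
  simp only [bgkDensity, bgkMomentum, Function.uncurry, maxwellian₁, maxwellian₂] at *
  have r1 := eq_sub_of_add_eq q1
  have r2 := eq_add_of_sub_eq q2
  constructor
  · rw [r1, r2]
    ring
  · rw [r1, r2]
    field_simp
    ring

end Macroscopic

/-! ### Convergence to the limit equation -/

section Convergence

open scoped Real

variable {lam s T ε : ℝ} {f u₀ : ℝ → ℝ} {ubar f₁ f₂ : ℝ → ℝ → ℝ}

/-- The limit solution is bounded. -/
theorem IsSmoothSolution.abs_le_stripSup (h : IsSmoothSolution lam f s T u₀ ubar) (hs : 1 ≤ s)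
    {t : ℝ} (ht : t ∈ Icc 0 T) (x : ℝ) : |ubar t x| ≤ stripSup T ubar := by
  obtain ⟨G, hG, hb⟩ := h.sobolev
  obtain ⟨A, hA⟩ := isCompact_Icc.exists_bound_of_continuousOn hG
  have hbdd : BddAbove (range fun p : Icc (0 : ℝ) T × ℝ => |ubar p.1 p.2|) := by
    refine ⟨√(2 * ((2 * π) ^ 4 * A ^ 2)), ?_⟩
    rintro _ ⟨⟨τ, y⟩, rfl⟩
    exact abs_le_of_hasBesselPotential (by linarith) (h.contDiff_slice τ τ.2) (hb τ τ.2)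
      (hA τ τ.2) y
  exact le_ciSup hbdd ((⟨t, ht⟩ : Icc (0 : ℝ) T), x)

/-- The `L²` bound of the initial time derivative of a limit solution with initial Bessel
potential of norm `g`, in terms of a local bound `L` of the derivative of the flux. -/
noncomputable def initialBound (lam : ℝ) (L : ℝ → ℝ) (g : ℝ) : ℝ :=
  2 * (L √(2 * ((2 * π) ^ 4 * (g + 1) ^ 2)) ^ 2 + lam ^ 4) * ((2 * π) ^ 4 * (g + 1) ^ 2)

/-- The difference between the density of the BGK model and the limit solution is of order `ε²`. -/
theorem integral_sq_density_sub_le (hlam : 0 < lam) (hf : ContDiff ℝ ∞ f) {L : ℝ → ℝ}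
    (hL : ∀ ρ y, |y| ≤ ρ → |deriv f y| ≤ L ρ) (hs : 1 ≤ s) (hT : 0 < T) (hε : 0 < ε)
    (h : IsSmoothSolution lam f s T u₀ ubar) {G₀ : Lp ℂ 2 (volume : Measure ℝ)}
    (hG₀ : HasBesselPotential (s + 1) u₀ G₀) (hbgk : IsBGKSolution lam f ε T f₁ f₂)
    (hi₁ : ∀ x, f₁ 0 x = correctedMaxwellian₁ lam f ε u₀ x)
    (hi₂ : ∀ x, f₂ 0 x = correctedMaxwellian₂ lam f ε u₀ x) {ρ : ℝ}
    (hρ : ∀ t ∈ Icc 0 T, ∀ x, |f₁ t x + f₂ t x| ≤ ρ ∧ |ubar t x| ≤ ρ)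
    {t : ℝ} (ht : t ∈ Icc 0 T) {R : ℝ} (hR : 0 < R) :
    ∫ x in -R..R, (f₁ t x + f₂ t x - ubar t x) ^ 2
      ≤ ε ^ 4 * initialBound lam L ‖G₀‖ * Real.exp (2 * L ρ ^ 2 / lam ^ 2 * t) := by
  obtain ⟨G, hG, hb⟩ := h.sobolev
  obtain ⟨A, hA⟩ := isCompact_Icc.exists_bound_of_continuousOn hG
  have hσ : 2 ≤ s + 1 := by linarith
  have h0 : G 0 = G₀ := by
    have := hb 0 (left_mem_Icc.2 hT.le)
    rw [h.initial] at this
    exact this.unique hG₀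
  have hubar : ContDiffOn ℝ 1 (Function.uncurry ubar) (openStrip T) := h.smooth.of_le (by simp)
  have hvb : ContDiffOn ℝ 1 (viscousFlux lam f ubar) (openStrip T) :=
    (h.contDiffOn_viscousFlux hf).of_le (by simp)
  refine integral_sq_le_of_relative_energy (lam := lam) (ε := ε) (L := L ρ)
    (B := 2 * (L ρ ^ 2 + lam ^ 4) * ((2 * π) ^ 4 * A ^ 2))
    (w := fun y => bgkDensity f₁ f₂ y - Function.uncurry ubar y)
    (z := fun y => bgkMomentum lam ε f₁ f₂ y - viscousFlux lam f ubar y)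
    (p := fun y => -dt (Function.uncurry ubar) y) (r := dt (viscousFlux lam f ubar))
    (d := fun y => f (bgkDensity f₁ f₂ y) - f (Function.uncurry ubar y))
    (b := fun y => deriv f (Function.uncurry ubar y)) hT hlam hε (by positivity)
    (hbgk.contDiffOn_density.sub hubar) (hbgk.contDiffOn_momentum.sub hvb)
    ((contDiffOn_dt h.smooth).of_le (by simp)).neg
    ((contDiffOn_dt (h.contDiffOn_viscousFlux hf)).of_le (by simp)) ?_ ?_
    (fun y hy => h.dt_dt_eq hf hy) ?_ ?_ ?_ ?_
    (hbgk.continuousOn_density.sub h.cont)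
    (hbgk.continuousOn_momentum.sub (h.continuousOn_viscousFlux hf)) ?_ ?_ ?_ ht hR
  · rintro ⟨τ, x⟩ hy
    have hτ : τ ∈ Ioo 0 T := hy.1
    rw [(hasDerivAt_dt (hbgk.contDiffOn_density.sub hubar) hτ x).unique
        ((hasDerivAt_dt hbgk.contDiffOn_density hτ x).fun_sub (hasDerivAt_dt hubar hτ x)),
      (hasDerivAt_dx (hbgk.contDiffOn_momentum.sub hvb) hτ x).unique
        ((hasDerivAt_dx hbgk.contDiffOn_momentum hτ x).fun_sub (hasDerivAt_dx hvb hτ x)),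
      (hbgk.macroscopic hlam hε hy).1, h.dx_viscousFlux hf hy]
    ring
  · rintro ⟨τ, x⟩ hy
    have hτ : τ ∈ Ioo 0 T := hy.1
    rw [(hasDerivAt_dx (hbgk.contDiffOn_density.sub hubar) hτ x).unique
        ((hasDerivAt_dx hbgk.contDiffOn_density hτ x).fun_sub (hasDerivAt_dx hubar hτ x)),
      (hasDerivAt_dt (hbgk.contDiffOn_momentum.sub hvb) hτ x).unique
        ((hasDerivAt_dt hbgk.contDiffOn_momentum hτ x).fun_sub (hasDerivAt_dt hvb hτ x)),
      mul_sub, (hbgk.macroscopic hlam hε hy).2, h.viscousFlux_eqOn hy]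
    ring
  · rintro ⟨τ, x⟩ hy
    have hτ : τ ∈ Ioo 0 T := hy.1
    have e : dx (fun y => -dt (Function.uncurry ubar) y) (τ, x)
        = -dx (dt (Function.uncurry ubar)) (τ, x) := by
      have hc : ContDiffOn ℝ 1 (dt (Function.uncurry ubar)) (openStrip T) :=
        (contDiffOn_dt h.smooth).of_le (by simp)
      exact (hasDerivAt_dx hc.neg hτ x).unique (hasDerivAt_dx hc hτ x).fun_neg
    rw [e, h.dt_viscousFlux hf hy]
    ring
  · rintro ⟨τ, x⟩ hy
    have hτ := hρ τ (Ioo_subset_Icc_self hy.1) x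
    exact abs_sub_le_of_deriv_bound hf (hL ρ) hτ.1 hτ.2
  · rintro ⟨τ, x⟩ hy
    exact hL ρ _ (hρ τ (Ioo_subset_Icc_self hy.1) x).2
  · intro τ hτ R hR
    have hτ' := Ioo_subset_Icc_self hτ
    exact h.integral_dt_sq_le hf hσ hτ (hb τ hτ') (hA τ hτ') (fun x => hL ρ _ (hρ τ hτ' x).2) hR
  · intro x
    simp only [bgkDensity, Function.uncurry, hi₁, hi₂, h.initial, correctedMaxwellian₁,
      correctedMaxwellian₂, maxwellian₁, maxwellian₂]
    ring
  · intro x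
    simp only [bgkMomentum, viscousFlux, Function.uncurry, hi₁, hi₂, h.initial,
      correctedMaxwellian₁, correctedMaxwellian₂, maxwellian₁, maxwellian₂]
    field_simp
    ring
  · have hG0 : Tendsto G (𝓝[>] 0) (𝓝 G₀) := by
      rw [← h0, ← nhdsWithin_Ioc_eq_nhdsGT hT]
      exact (hG 0 (left_mem_Icc.2 hT.le)).mono_left (nhdsWithin_mono _ Ioc_subset_Icc_self)
    filter_upwards [hG0.norm.eventually (gt_mem_nhds (lt_add_one ‖G₀‖)), Ioo_mem_nhdsGT hT]
      with τ hτG hτ R hR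
    have hτ' := Ioo_subset_Icc_self hτ
    exact h.integral_dt_sq_le hf hσ hτ (hb τ hτ') (le_of_lt hτG) (fun x => hL _ _
      (abs_le_of_hasBesselPotential hσ (h.contDiff_slice τ hτ') (hb τ hτ') (le_of_lt hτG) x)) hR

end Convergence

theorem theorem2 (lam : ℝ) (hlam : 0 < lam) (f : ℝ → ℝ) (a : ℝ) (hf : FluxAssumption f a)
    (M : ℝ) (hM : 0 < M) :
    ∃ K : ℝ → ℝ → ℝ, ∀ ε₀ : ℝ, 0 < ε₀ → ∀ s : ℝ, 1 / 2 + 1 < s →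
    ∀ u₀ : ℝ → ℝ, InSobolev (s + 1) u₀ →
    ∃ C : ℝ, 0 < C ∧ ∀ T : ℝ, 0 < T →
    ∀ ubar : ℝ → ℝ → ℝ, IsSmoothSolution lam f s T u₀ ubar →
    ∀ ε : ℝ, 0 < ε → ε ≤ ε₀ →
    ∀ f₁ f₂ : ℝ → ℝ → ℝ, IsBGKSolution lam f ε T f₁ f₂ →
    (∀ x, f₁ 0 x = correctedMaxwellian₁ lam f ε u₀ x) →
    (∀ x, f₂ 0 x = correctedMaxwellian₂ lam f ε u₀ x) →
    ∀ E : KineticEntropy lam f ε, E.Carries T f₁ f₂ →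
    (∀ t ∈ Set.Icc 0 T, ∀ x, |f₁ t x| ≤ M ∧ |f₂ t x| ≤ M) →
    (∀ t ∈ Set.Ioo 0 T, ∀ x,
      |deriv (fun τ => f₁ τ x) t| ≤ M ∧ |deriv (fun τ => f₂ τ x) t| ≤ M) →
    ∀ t ∈ Set.Icc 0 T,
      MeasureTheory.eLpNorm (fun x => f₁ t x + f₂ t x - ubar t x) 2 MeasureTheory.volume
        ≤ ENNReal.ofReal (C * Real.sqrt ε *
            Real.exp (K (stripSup T ubar) (stripSup T (fun τ => deriv (ubar τ))) * t)) := by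
  obtain ⟨L, hL⟩ := exists_deriv_bound hf.contDiff
  refine ⟨fun A _ => L (max (2 * M) A) ^ 2 / lam ^ 2, fun ε₀ hε₀ s hs u₀ ⟨hg₀, G₀, hG₀⟩ => ?_⟩
  set C₀ := initialBound lam L ‖G₀‖ with hC₀
  have hC₀' : 0 ≤ C₀ := by
    rw [hC₀, initialBound]
    positivity
  refine ⟨ε₀ * √ε₀ * √C₀ + 1, by positivity, ?_⟩
  intro T hT ubar hubar ε hε hεε₀ f₁ f₂ hbgk hi₁ hi₂ _ _ hbound _ t ht
  set ρ := max (2 * M) (stripSup T ubar) with hρdef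
  have hρ : ∀ τ ∈ Icc 0 T, ∀ x, |f₁ τ x + f₂ τ x| ≤ ρ ∧ |ubar τ x| ≤ ρ := fun τ hτ x =>
    ⟨((abs_add_le _ _).trans (by linarith [(hbound τ hτ x).1, (hbound τ hτ x).2])).trans
        (le_max_left _ _),
      (hubar.abs_le_stripSup (by linarith) hτ x).trans (le_max_right _ _)⟩
  have hslice : ∀ {g : ℝ → ℝ → ℝ}, ContinuousOn (Function.uncurry g) (Icc 0 T ×ˢ univ) →
      Continuous (g t) := fun hg =>
    hg.comp_continuous (f := fun x : ℝ => (t, x)) (by fun_prop) fun x => ⟨ht, mem_univ x⟩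
  refine eLpNorm_two_le_of_intervalIntegral_le
    (((hslice hbgk.cont₁).add (hslice hbgk.cont₂)).sub (hslice hubar.cont)) (by positivity)
    fun R hR => ?_
  refine (integral_sq_density_sub_le hlam hf.contDiff hL (by linarith) hT hε hubar ⟨hg₀, hG₀⟩ hbgk
    hi₁ hi₂ hρ ht hR).trans ?_
  have hexp : Real.exp (2 * L ρ ^ 2 / lam ^ 2 * t) = Real.exp (L ρ ^ 2 / lam ^ 2 * t) ^ 2 := by
    rw [← Real.exp_nat_mul]
    congr 1
    push_cast
    ring
  have hrate : ε ^ 2 * √C₀ ≤ (ε₀ * √ε₀ * √C₀ + 1) * √ε := by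
    calc ε ^ 2 * √C₀ = ε * √ε * √C₀ * √ε := by
          rw [sq]
          nth_rewrite 2 [← Real.mul_self_sqrt hε.le]
          ring
      _ ≤ (ε₀ * √ε₀ * √C₀ + 1) * √ε := by
          have h1 : ε * √ε * √C₀ ≤ ε₀ * √ε₀ * √C₀ := by gcongr
          gcongr
          linarith
  calc ε ^ 4 * C₀ * Real.exp (2 * L ρ ^ 2 / lam ^ 2 * t)
      = (ε ^ 2 * √C₀ * Real.exp (L ρ ^ 2 / lam ^ 2 * t)) ^ 2 := by
        rw [hexp, mul_pow, mul_pow, Real.sq_sqrt hC₀']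
        ring
    _ ≤ _ := by gcongr
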